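/- \textbf{Setting.} A configuration is a subset $\varphi\subset\mathbb Z^3$; it is admissible for $D^2=6$ if distinct $x,y\in\varphi$ have Euclidean distance $\rho(x,y)\ge\sqrt6$. Let $f(0)=1$, $f(1)=\frac23$, $f(2)=\frac13$, $f(3)=\frac18$, $f(4)=\frac16$, $f(5)=\frac1{24}$, and put $$U(\varphi,x)=\frac1{12}\sum_{y\in\varphi,\ \rho(x,y)<\sqrt6}f(\rho(x,y)^2),\qquad x\in\mathbb Z^3 .$$ A perfect configuration (PC) for $D^2=6$ is an admissible $\varphi$ such that, for every $x\in\mathbb Z^3$, $U(\varphi,x)$ equals the maximum of $U(\psi,y)$ over all admissible $\psi$ and all $y\in\mathbb Z^3$. A configuration is periodic if it is invariant under three linearly independent integer shifts. Its particle density is $\lim_{n\to\infty}|\varphi\cap[-n,n]^3|/(2n+1)^3$. \textbf{Triangular family.} Let $(1,s_2,s_3)$ be one of the main diagonals $(1,1,1),(1,-1,1),(1,-1,-1),(1,1,-1)$. Put $w_1=(1,-2s_2,s_3)$, $w_2=(-1,-s_2,2s_3)$, $w_3=(-2,s_2,s_3)$, $w_4=-w_1$, $w_6=-w_3$, and let $\tau=\{mw_1+nw_2: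 m,n\in\mathbb Z\}$, a triangular $\sqrt6$-lattice. An allowed stacking is a sequence of meshes $(\gamma_k)_{k\in\mathbb Z}$ with $\gamma_0=\tau$ and, for every $k\in\mathbb Z$, $\gamma_{k+1}=\gamma_k+\frac13w_j$ for some $j\in\{2,4,6\}$. The corresponding layered configuration is $\bigcup_{k\in\mathbb Z}\bigl(\frac{4k}3(1,s_2,s_3)+\gamma_k\bigr)\subset\mathbb Z^3$. \textbf{Rhombic family.} Let $s=(s_1,s_2,s_3)$ be one of the non-main diagonals $(1,1,0),(-1,1,0),(1,0,1),(-1,0,1),(0,1,1),(0,-1,1)$. Put $a=(1-|s_1|,1-|s_2|,1-|s_3|)$ and $$b=\tfrac12\bigl(s_2-s_2|s_3|-s_3+s_3|s_2|,\ s_3-s_3|s_1|-s_1+s_1|s_3|,\ s_1-s_1|s_2|-s_2+s_2|s_1|\bigr),$$ so that $s,a,b$ are orthogonal, $|a|=1$ and $|b|=\sqrt2/2$. Let $\alpha=\{m(2a+2b)+n(2a-2b): m,n\in\mathbb Z\}$, a rhombic lattice with rhombus diagonals $\sqrt8,\sqrt{16}$. An allowed stacking is a sequence of meshes $(\gamma_k)_{k\in\mathbb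 Z}$ with $\gamma_0=\alpha$ and, for every $k\in\mathbb Z$, $\gamma_{k+1}=\gamma_k+a+b$ or $\gamma_{k+1}=\gamma_k+a-b$. The corresponding layered configuration is $\bigcup_{k\in\mathbb Z}\bigl(\frac{3k}2s+\gamma_k\bigr)\subset\mathbb Z^3$. Let $\mathscr S^{(6)}$ be the set of all layered configurations of both families and all their $\mathbb Z^3$-shifts, and let $\mathscr S^{(6)}_{\rm per}$ be the subset given by the periodic stackings (those with $\gamma_{k+p}=\gamma_k$ for all $k$, for some $p\ge1$) and their $\mathbb Z^3$-shifts. \textbf{Theorem.} The set of all PCs for $D^2=6$ is $\mathscr S^{(6)}$, and $\mathscr S^{(6)}$ has the cardinality of the continuum. The set of all periodic PCs for $D^2=6$ is $\mathscr S^{(6)}_{\rm per}$, and $\mathscr S^{(6)}_{\rm per}$ is countably infinite. Every configuration in $\mathscr S^{(6)}$ has particle density $1/12$. -/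

import Mathlib

/-! ### Configurations on `ℤ³` and the local repelling forces for `D² = 6` -/

/-- A site of the cubic lattice `ℤ³`. A configuration is identified with its set of occupied
sites. -/
abbrev Site := Fin 3 → ℤ

/-- The square `ρ(x, y)²` of the Euclidean distance between two sites. -/
def sqDist (x y : Site) : ℤ := ∑ l, (x l - y l) ^ 2

/-- `D`-admissibility, with `d = D²`: distinct occupied sites are at Euclidean distance at least
`D` from each other. -/
def Admissible (d : ℤ) (φ : Set Site) : Prop := φ.Pairwise fun x y => d ≤ sqDist x y

/-- The open lattice ball `B(x) = {y ∈ ℤ³ : ρ(x, y) < √6}`; see `mem_ball`. -/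
noncomputable def ball (x : Site) : Finset Site :=
  (Finset.Icc (fun l => x l - 2) (fun l => x l + 2)).filter fun y => sqDist x y < 6

theorem mem_ball (x y : Site) : y ∈ ball x ↔ sqDist x y < 6 := by
  unfold ball
  rw [Finset.mem_filter, Finset.mem_Icc, and_iff_right_iff_imp]
  intro h
  have key : ∀ l, (x l - y l) ^ 2 < 6 := fun l =>
    lt_of_le_of_lt
      (Finset.single_le_sum (f := fun l => (x l - y l) ^ 2) (fun i _ => sq_nonneg _)
        (Finset.mem_univ l)) h
  constructor <;> intro l <;> have := key l <;> simp only <;> nlinarith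

/-- The local repelling forces for `D² = 6`, as a function of the squared distance. -/
def force (t : ℤ) : ℚ :=
  if t = 0 then 1
  else if t = 1 then 2 / 3
  else if t = 2 then 1 / 3
  else if t = 3 then 1 / 8
  else if t = 4 then 1 / 6
  else if t = 5 then 1 / 24
  else 0

open Classical in
/-- The potential `U(φ↾B(x)) = (1/12) ∑_{y ∈ B(x)} φ(y) f(ρ(x, y)²)`, i.e. the total force acting on
the site `x` divided by the normalizing constant `∑_y f(ρ(x, y)²) = 12`. For fugacity `u > 1` the
energy `- ln u` per particle is distributed over the sites as `- ln u · U`, so least local energy is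
greatest `U`. -/
noncomputable def potential (φ : Set Site) (x : Site) : ℚ :=
  1 / 12 * ∑ y ∈ ball x, if y ∈ φ then force (sqDist x y) else 0

/-- Perfect configurations for `D² = 6`: the admissible configurations for which the local potential
at every site has its optimal value, the optimum being taken over all sites and all admissible
configurations. -/
def IsPerfect (φ : Set Site) : Prop :=
  Admissible 6 φ ∧
    ∀ x, IsGreatest {t : ℚ | ∃ (y : Site) (ψ : Set Site), Admissible 6 ψ ∧ potential ψ y = t}
      (potential φ x)

/-- Periodicity: invariance under the shifts by three linearly independent integer vectors. -/
def IsPeriodic (φ : Set Site) : Prop :=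
  ∃ e : Fin 3 → Site, LinearIndependent ℤ e ∧ ∀ i x, x + e i ∈ φ ↔ x ∈ φ

/-- Particle density: the limit of the fraction of occupied sites in the cubes `[-n, n]³`. -/
def HasDensity (φ : Set Site) (δ : ℝ) : Prop :=
  Filter.Tendsto
    (fun n : ℕ => ((φ ∩ Set.Icc (fun _ => -(n : ℤ)) (fun _ => (n : ℤ))).ncard : ℝ)
      / (2 * (n : ℝ) + 1) ^ 3)
    Filter.atTop (nhds δ)

/-! ### Meshes and layered configurations

All the meshes below consist of points with rational coordinates. -/

/-- Points with rational coordinates. -/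
abbrev Pt := Fin 3 → ℚ

/-- The shift `χ + v`. -/
def shift {G : Type*} [Add G] (χ : Set G) (v : G) : Set G := (fun x => x + v) '' χ

/-- The sites of `ℤ³` that lie in a set of points. -/
def sitesOf (χ : Set Pt) : Set Site := {x | (fun l => (x l : ℚ)) ∈ χ}

/-- The two-dimensional lattice generated by `g₁` and `g₂`. -/
def planeLattice (g₁ g₂ : Pt) : Set Pt := {p | ∃ m n : ℤ, p = (m : ℚ) • g₁ + (n : ℚ) • g₂}

/-- The four main diagonals `(1, s₂, s₃)`. -/
def mainDiag : Fin 4 → Pt := ![![1, 1, 1], ![1, -1, 1], ![1, -1, -1], ![1, 1, -1]]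

/-- The vectors `w₀ = 0` and `w₁, …, w₆` of length `√6` orthogonal to a main diagonal. -/
def triVec (i : Fin 4) : Fin 7 → Pt :=
  let s₂ := mainDiag i 1
  let s₃ := mainDiag i 2
  ![![0, 0, 0],
    ![1, -2 * s₂, s₃], ![-1, -s₂, 2 * s₃], ![-2, s₂, s₃],
    -![1, -2 * s₂, s₃], -![-1, -s₂, 2 * s₃], -![-2, s₂, s₃]]

/-- The triangular `√6`-lattice orthogonal to a main diagonal. -/
def triMesh (i : Fin 4) : Set Pt := planeLattice (triVec i 1) (triVec i 2)

/-- Allowed stackings of triangular meshes; `γ k` is the orthogonal projection of the `k`-th layer to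
the plane through the origin. Successive projected meshes differ by a shift by `w_j / 3` with
`j ∈ {2, 4, 6}`. -/
def IsTriStacking (i : Fin 4) (γ : ℤ → Set Pt) : Prop :=
  γ 0 = triMesh i ∧
    ∀ k, ∃ j : Fin 7, (j = 2 ∨ j = 4 ∨ j = 6) ∧ γ (k + 1) = shift (γ k) ((1 / 3 : ℚ) • triVec i j)

/-- The layered configuration whose `k`-th layer is `(4k/3) (1, s₂, s₃) + γ k`, a mesh in the plane
`x₁ + s₂ x₂ + s₃ x₃ = 4k`. -/
def triLayered (i : Fin 4) (γ : ℤ → Set Pt) : Set Site :=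
  sitesOf (⋃ k : ℤ, shift (γ k) ((4 * (k : ℚ) / 3) • mainDiag i))

/-- The six non-main diagonals `(s₁, s₂, s₃)`. -/
def nonMainDiag : Fin 6 → Pt :=
  ![![1, 1, 0], ![-1, 1, 0], ![1, 0, 1], ![-1, 0, 1], ![0, 1, 1], ![0, -1, 1]]

/-- The unit vector `a` along the coordinate axis orthogonal to a non-main diagonal. -/
def vecA (i : Fin 6) : Pt := fun l => 1 - |nonMainDiag i l|

/-- The vector `b` of length `√2 / 2` orthogonal to a non-main diagonal and to `a`. -/
def vecB (i : Fin 6) : Pt :=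
  let s₁ := nonMainDiag i 0
  let s₂ := nonMainDiag i 1
  let s₃ := nonMainDiag i 2
  (1 / 2 : ℚ) •
    ![s₂ - s₂ * |s₃| - s₃ + s₃ * |s₂|,
      s₃ - s₃ * |s₁| - s₁ + s₁ * |s₃|,
      s₁ - s₁ * |s₂| - s₂ + s₂ * |s₁|]

/-- The rhombic lattice, generated by two vectors of length `√6`, whose rhombus has diagonals
`√8` and `√16`. -/
def rhoMesh (i : Fin 6) : Set Pt :=
  planeLattice ((2 : ℚ) • vecA i + (2 : ℚ) • vecB i) ((2 : ℚ) • vecA i - (2 : ℚ) • vecB i)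

/-- Allowed stackings of rhombic meshes; `γ k` is the orthogonal projection of the `k`-th layer to the
plane through the origin. Successive projected meshes differ by a shift by `a + b` or `a - b`. -/
def IsRhoStacking (i : Fin 6) (γ : ℤ → Set Pt) : Prop :=
  γ 0 = rhoMesh i ∧
    ∀ k, γ (k + 1) = shift (γ k) (vecA i + vecB i) ∨ γ (k + 1) = shift (γ k) (vecA i - vecB i)

/-- The layered configuration whose `k`-th layer is `(3k/2) (s₁, s₂, s₃) + γ k`, a mesh in the plane
`s₁ x₁ + s₂ x₂ + s₃ x₃ = 3k`. -/
def rhoLayered (i : Fin 6) (γ : ℤ → Set Pt) : Set Site :=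
  sitesOf (⋃ k : ℤ, shift (γ k) ((3 * (k : ℚ) / 2) • nonMainDiag i))

/-- A sequence of meshes is periodic if it is obtained by repeating a finite string. -/
def IsPeriodicStacking (γ : ℤ → Set Pt) : Prop := ∃ p : ℕ, 0 < p ∧ ∀ k, γ (k + p) = γ k

/-- The set `𝒮⁽⁶⁾`: all layered configurations of the two families and their `ℤ³`-shifts. -/
def layeredSet : Set (Set Site) :=
  {φ | ∃ v : Site,
    (∃ i γ, IsTriStacking i γ ∧ φ = shift (triLayered i γ) v) ∨
    (∃ i γ, IsRhoStacking i γ ∧ φ = shift (rhoLayered i γ) v)}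

/-- The subset of `𝒮⁽⁶⁾` given by the periodic stackings. -/
def periodicLayeredSet : Set (Set Site) :=
  {φ | ∃ v : Site,
    (∃ i γ, IsTriStacking i γ ∧ IsPeriodicStacking γ ∧ φ = shift (triLayered i γ) v) ∨
    (∃ i γ, IsRhoStacking i γ ∧ IsPeriodicStacking γ ∧ φ = shift (rhoLayered i γ) v)}

/-! Multiply the forces by 24 to make them integers. The ball splits into `cliques`, each with at
most one occupied site, and a branch and bound over them shows that an admissible configuration has
weight at most 24 in a ball, with equality only if it contains one of the `patterns`. A lone
particle attains the bound at its own site. So a configuration is perfect exactly when it is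
admissible and has a pattern around every site (`isPerfect_iff`).

Rigidity then follows from finite searches over the patterns at sites near an occupied one. By
`forces_nbhd` an occupied site has the neighbours prescribed by one of ten layer systems (four
triangular, six rhombic), where the steps up and down differ or the system is triangular. In the
first case the neighbourhood spreads along its layer (`forces_rigid`); in the second each neighbour
inherits it or has a neighbourhood of the first kind (`forces_lattice`). Either way some layer is
complete. A complete layer forces complete layers above and below (`forces_step`), so the
configuration contains a full stack.

Conversely every stack is perfect: admissibility and the presence of patterns involve only adjacent
layers and finitely many residue classes. Since perfect configurations are maximal among admissible
ones (`IsPerfect.eq_of_subset`), containing a stack means being equal to it.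

Stackings are encoded by paths of sites, one in each layer. Binary step sequences give continuum
many stacks; periodic configurations are countable because each is a union of classes modulo some
`N`. The density comes from double counting: each site receives potential 1/12 and each particle
distributes potential 1 in all. -/

/-! ### Bit masks for finite sets of sites -/

/-- The bilinear form on sites. -/
def dot (u v : Site) : ℤ := u 0 * v 0 + u 1 * v 1 + u 2 * v 2

/-- The weight `24 f(t)` of a site at squared distance `t`. -/
def weight (t : ℤ) : ℕ :=
  if t = 0 then 24 else if t = 1 then 16 else if t = 2 then 8 else if t = 3 then 3
  else if t = 4 then 4 else if t = 5 then 1 else 0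

/-- The sites of the ball around the origin, grouped into sets of diameter less than `√6`. -/
def cliques : List (List Site) :=
  [[![0, 0, 0], ![1, 0, 0], ![-1, 0, 0], ![0, 1, 0], ![0, -1, 0], ![0, 0, 1], ![0, 0, -1]],
   [![1, 1, 0], ![0, 1, 1], ![1, 0, 1]], [![-1, -1, 0], ![0, -1, 1], ![-1, 0, 1]],
   [![-1, 1, 0], ![0, 1, -1], ![-1, 0, -1]], [![1, -1, 0], ![0, -1, -1], ![1, 0, -1]],
   [![1, 1, 1], ![1, 1, -1]], [![1, -1, 1], ![1, -1, -1]],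
   [![-1, 1, 1], ![-1, 1, -1]], [![-1, -1, 1], ![-1, -1, -1]],
   [![2, 0, 0], ![2, 1, 0], ![2, -1, 0], ![2, 0, 1], ![2, 0, -1]],
   [![-2, 0, 0], ![-2, 1, 0], ![-2, -1, 0], ![-2, 0, 1], ![-2, 0, -1]],
   [![0, 2, 0], ![1, 2, 0], ![-1, 2, 0], ![0, 2, 1], ![0, 2, -1]],
   [![0, -2, 0], ![1, -2, 0], ![-1, -2, 0], ![0, -2, 1], ![0, -2, -1]],
   [![0, 0, 2], ![1, 0, 2], ![-1, 0, 2], ![0, 1, 2], ![0, -1, 2]],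
   [![0, 0, -2], ![1, 0, -2], ![-1, 0, -2], ![0, 1, -2], ![0, -1, -2]]]

/-- The sites of the ball around the origin. -/
def ballSites : List Site := cliques.flatten

/-- The site of the cube `[-2, 2]³` with a given index. -/
def siteOfIndex (n : ℕ) : Site :=
  ![((n % 5 : ℕ) : ℤ) - 2, ((n / 5 % 5 : ℕ) : ℤ) - 2, ((n / 25 : ℕ) : ℤ) - 2]

/-- The admissible subsets of the ball around the origin of total weight `24`, grouped by their site
closest to the origin. -/
def clusters : List (Site × List (List Site)) :=
  List.map (fun q => (siteOfIndex q.1, q.2.map (List.map siteOfIndex))) [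
   -- The index is (y₀+2) + 5(y₁+2) + 25(y₂+2), so 62 is the origin, whose weight is already 24.
   (62, [[]]),
   (61, [[33, 93, 77, 17], [33, 93, 77, 47], [33, 93, 107, 17], [33, 93, 107, 47], [33, 77, 17,
     117, 73, 89], [33, 77, 17, 97, 113, 69], [83, 43, 27, 117], [83, 43, 27, 97], [83, 43, 7,
     117], [83, 43, 7, 97], [83, 27, 17, 117, 73, 39], [83, 27, 117, 47, 13, 69], [43, 77, 7, 97,
     113, 59], [43, 7, 107, 97, 53, 89], [93, 27, 107, 47, 13, 59], [93, 7, 107, 47, 53, 39], [64,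
     27, 107, 17, 97], [64, 77, 7, 117, 47]]),
   (57, [[41, 93, 85, 13], [41, 93, 85, 39], [41, 93, 111, 13], [41, 93, 111, 39], [41, 85, 117,
     13, 73, 89], [41, 85, 97, 13, 113, 69], [91, 43, 35, 113], [91, 43, 35, 89], [91, 43, 11,
     113], [91, 43, 11, 89], [91, 35, 17, 113, 73, 39], [91, 35, 47, 13, 113, 69], [43, 85, 11,
     71, 117, 89], [43, 65, 11, 111, 97, 89], [93, 35, 111, 71, 17, 39], [93, 65, 11, 111, 47,
     39], [72, 35, 111, 13, 89], [72, 85, 11, 113, 39]]),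
   (37, [[81, 93, 65, 53], [81, 93, 65, 59], [81, 93, 71, 53], [81, 93, 71, 59], [81, 65, 117, 53,
     73, 89], [81, 65, 97, 53, 113, 69], [91, 83, 55, 73], [91, 83, 55, 69], [91, 83, 51, 73],
     [91, 83, 51, 69], [91, 55, 77, 113, 73, 59], [91, 55, 107, 53, 73, 89], [83, 85, 51, 71, 117,
     69], [83, 65, 51, 111, 97, 69], [93, 55, 111, 71, 77, 59], [93, 85, 51, 71, 107, 59], [112,
     55, 71, 53, 69], [112, 65, 51, 73, 59]]),
   (87, [[31, 43, 65, 53], [31, 43, 65, 59], [31, 43, 71, 53], [31, 43, 71, 59], [31, 65, 17, 53,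
     73, 39], [31, 65, 47, 53, 13, 69], [41, 33, 55, 73], [41, 33, 55, 69], [41, 33, 51, 73], [41,
     33, 51, 69], [41, 55, 27, 13, 73, 59], [41, 55, 7, 53, 73, 39], [33, 35, 51, 71, 17, 69],
     [33, 65, 51, 11, 47, 69], [43, 55, 11, 71, 27, 59], [43, 35, 51, 71, 7, 59], [12, 55, 71, 53,
     69], [12, 65, 51, 73, 59]]),
   (67, [[31, 83, 85, 13], [31, 83, 85, 39], [31, 83, 111, 13], [31, 83, 111, 39], [31, 85, 77,
     13, 113, 59], [31, 85, 107, 53, 13, 89], [81, 33, 35, 113], [81, 33, 35, 89], [81, 33, 11,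
     113], [81, 33, 11, 89], [81, 35, 27, 13, 113, 59], [81, 35, 7, 53, 113, 39], [33, 55, 11,
     111, 77, 89], [33, 85, 51, 11, 107, 89], [83, 55, 11, 111, 27, 39], [83, 35, 51, 111, 7, 39],
     [52, 35, 111, 13, 89], [52, 85, 11, 113, 39]]),
   (63, [[31, 91, 77, 17], [31, 91, 77, 47], [31, 91, 107, 17], [31, 91, 107, 47], [31, 85, 71,
     77, 17, 117], [31, 65, 111, 77, 17, 97], [81, 41, 27, 117], [81, 41, 27, 97], [81, 41, 7,
     117], [81, 41, 7, 97], [81, 35, 71, 27, 17, 117], [81, 65, 11, 27, 117, 47], [41, 55, 111,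
     77, 7, 97], [41, 85, 51, 7, 107, 97], [91, 55, 11, 27, 107, 47], [91, 35, 51, 7, 107, 47],
     [60, 27, 107, 17, 97], [60, 77, 7, 117, 47]]),
   (56, [[42, 88], [42, 112, 64], [92, 38], [92, 12, 64], [38, 112, 72], [88, 12, 72], [68, 12,
     112], [12, 112, 72, 64]]),
   (36, [[82, 68], [82, 72, 64], [92, 58], [92, 52, 64], [58, 112, 72], [88, 52, 72], [68, 52,
     112], [52, 112, 72, 64]]),
   (86, [[32, 68], [32, 72, 64], [42, 58], [42, 52, 64], [58, 12, 72], [38, 52, 72], [68, 52, 12],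
     [52, 12, 72, 64]]),
   (66, [[32, 88], [32, 112, 64], [82, 38], [82, 12, 64], [58, 12, 112], [38, 52, 112], [88, 52,
     12], [52, 12, 112, 64]]),
   (32, [[92, 60, 64], [88, 60, 72], [68, 60, 112], [60, 112, 72, 64]]),
   (82, [[42, 60, 64], [38, 60, 72], [68, 60, 12], [60, 12, 72, 64]]),
   (42, [[58, 60, 112], [88, 60, 52], [60, 52, 112, 64]]),
   (92, [[58, 60, 12], [38, 60, 52], [60, 52, 12, 64]]),
   (58, [[60, 12, 112, 72]]),
   (38, [[60, 52, 112, 72]]),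
   (88, [[60, 52, 12, 72]]),
   (68, [[60, 52, 12, 112]]),
   (60, [[52, 12, 112, 72, 64]])]

/-- The admissible subsets of the ball around the origin of total weight `24`. -/
def patterns : List (List Site) := clusters.flatMap fun q => q.2.map (q.1 :: ·)

/-- The position of a site in a bit mask with offset `o`. -/
def bitIndex (o : ℤ) (y : Site) : ℕ := (y 0 + 16 * y 1 + 256 * y 2 + o).toNat

/-- The bit mask of a list of sites. -/
def mask (o : ℤ) (l : List Site) : ℕ := l.foldr (fun y m => 1 <<< bitIndex o y ||| m) 0

/-- The mask of the punctured ball. -/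
def nearMask : ℕ := mask 546 ballSites.tail

/-- The mask of the sites that are in conflict with a site of a pattern. -/
def conflictMask (l : List Site) : ℕ :=
  l.foldr (fun y m => nearMask <<< bitIndex 546 y ||| m) 0

/-- The sum over the cliques of the greatest weights. -/
def weightBound (gs : List (List Site)) : ℕ :=
  gs.foldr (fun g n => g.foldr (fun p k => max (weight (dot p p)) k) 0 + n) 0

/-- Branch and bound over the cliques: every way to complete `occ` has weight at most `24`, with
equality only for the patterns. -/
def boundedBy (gs : List (List Site)) (occ tot : ℕ) : Bool :=
  match gs with
  | [] => Nat.blt tot 24 || (Nat.beq tot 24 && patterns.any fun P => Nat.beq (mask 2184 P) occ)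
  | g :: gs =>
    -- Cut the branch if even the heaviest site of every remaining clique leaves the total below 24.
    Nat.blt (tot + weightBound (g :: gs)) 24 ||
      -- Otherwise the clique stays empty or receives one site not in conflict with those chosen.
      (boundedBy gs occ tot && g.all fun p =>
        !(Nat.beq (nearMask <<< bitIndex 1638 p &&& occ) 0) ||
          boundedBy gs (1 <<< bitIndex 2184 p ||| occ) (tot + weight (dot p p)))

/-- Branching over the patterns at the sites `hs`, until one of the sets `goals` is occupied. -/
def resolves (goals : List ℕ) (hs : List ℕ) (occ : ℕ) : Bool :=
  (goals.any fun g => Nat.beq (g &&& occ) g) ||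
  match hs with
  | [] => false
  | h :: hs => clusters.all fun q =>
      -- A conflict with the common first site discards the whole group of patterns at once.
      !(Nat.beq (nearMask <<< bitIndex 546 q.1 <<< h &&& occ) 0) || q.2.all fun P =>
        !(Nat.beq (conflictMask P <<< h &&& occ) 0) ||
          -- The index `h` carries offset 1092; with 546 from the mask and 546 added here the offset
          -- is the standard 2184.
          resolves goals hs (mask 546 (q.1 :: P) <<< (h + 546) ||| occ)

/-! ### Layer systems: a common form for the two families -/

/-- A family of layered configurations: layers are translates of a two-dimensional lattice in the
planes on which `dot s` is a multiple of `h`. -/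
structure LayerSystem where
  /-- the normal vector -/
  s : Site
  /-- the value of `dot s` on the steps -/
  h : ℤ
  /-- the lattice consists of the sites orthogonal to `s` on which `dot c` is divisible by `m` -/
  c : Site
  m : ℤ
  /-- generators of the lattice -/
  g₁ : Site
  g₂ : Site
  /-- a functional that is `1` on `g₁` and `-1` on `g₂` -/
  e : Site
  /-- a site with `dot s = 1` and `dot c = 0` -/
  r₀ : Site
  /-- a site with `dot s = 0` and `dot c = 1` -/
  r₁ : Site
  /-- the steps from a layer to the next one -/
  steps : List Site

namespace LayerSystem

/-- The lattice of a layer system. -/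
def Lat (S : LayerSystem) (z : Site) : Prop := dot S.s z = 0 ∧ S.m ∣ dot S.c z

instance (S : LayerSystem) : DecidablePred S.Lat := fun _ => inferInstanceAs (Decidable (_ ∧ _))

end LayerSystem

/-- The signs of the second and third coordinates of a main diagonal. -/
def mainSign : Fin 4 → ℤ × ℤ := ![(1, 1), (-1, 1), (-1, -1), (1, -1)]

/-- The layer system of triangular meshes orthogonal to `(1, s₂, s₃)`. -/
def triSystem (i : Fin 4) : LayerSystem :=
  let s₂ := (mainSign i).1
  let s₃ := (mainSign i).2
  { s := ![1, s₂, s₃]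
    h := 4
    c := ![1, -s₂, 0]
    m := 3
    g₁ := ![1, -2 * s₂, s₃]
    g₂ := ![-1, -s₂, 2 * s₃]
    e := ![1, 0, 0]
    r₀ := ![0, 0, s₃]
    r₁ := ![0, -s₂, s₃]
    steps := [![1, s₂, 2 * s₃], ![1, 2 * s₂, s₃], ![2, s₂, s₃]] }

/-- The layer system of rhombic meshes orthogonal to `s`, with `a` a unit vector, `d = 2 b`,
`r₀`, `e` unit vectors. -/
def rhoSystemOf (s a d r e : Site) : LayerSystem where
  s := s
  h := 3
  c := 2 • e + a
  m := 4
  g₁ := 2 • a + d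
  g₂ := 2 • a - d
  e := e
  r₀ := r
  r₁ := a
  -- The division is exact, since in all the uses `s` and `d` agree modulo 2; the steps are (3/2)s +
  -- a ± b.
  steps := [fun l => (3 * s l + 2 * a l + d l) / 2, fun l => (3 * s l + 2 * a l - d l) / 2]

/-- The layer systems of rhombic meshes. -/
def rhoSystem : Fin 6 → LayerSystem :=
  ![rhoSystemOf ![1, 1, 0] ![0, 0, 1] ![1, -1, 0] ![0, 1, 0] ![1, 0, 0],
    rhoSystemOf ![-1, 1, 0] ![0, 0, 1] ![1, 1, 0] ![0, 1, 0] ![1, 0, 0],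
    rhoSystemOf ![1, 0, 1] ![0, 1, 0] ![-1, 0, 1] ![1, 0, 0] ![0, 0, 1],
    rhoSystemOf ![-1, 0, 1] ![0, 1, 0] ![-1, 0, -1] ![0, 0, 1] ![-1, 0, 0],
    rhoSystemOf ![0, 1, 1] ![1, 0, 0] ![0, 1, -1] ![0, 0, 1] ![0, 1, 0],
    rhoSystemOf ![0, -1, 1] ![1, 0, 0] ![0, 1, 1] ![0, 0, 1] ![0, 1, 0]]

/-- The sites at squared distance `6` from the origin. -/
def shell : List Site :=
  [![1, 1, 2], ![1, 1, -2], ![1, -1, 2], ![1, -1, -2], ![-1, 1, 2], ![-1, 1, -2], ![-1, -1, 2],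
   ![-1, -1, -2], ![1, 2, 1], ![1, -2, 1], ![1, 2, -1], ![1, -2, -1], ![-1, 2, 1], ![-1, -2, 1],
   ![-1, 2, -1], ![-1, -2, -1], ![2, 1, 1], ![-2, 1, 1], ![2, 1, -1], ![-2, 1, -1], ![2, -1, 1],
   ![-2, -1, 1], ![2, -1, -1], ![-2, -1, -1]]

namespace LayerSystem

/-- The sites of `u + Lat` that are closest to the origin. -/
def star (S : LayerSystem) (u : Site) : List Site := shell.filter fun v => S.Lat (v - u)

/-- The neighbourhood of an occupied site with steps `u` upwards and `d` downwards. -/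
def nbhd (S : LayerSystem) (u d : Site) : List Site := S.star 0 ++ S.star u ++ S.star (-d)

/-- Generators of the lattice, with their negatives. -/
def gens (S : LayerSystem) : List Site := [S.g₁, S.g₂, -S.g₁, -S.g₂]

end LayerSystem

/-- All the layer systems. -/
def systems : List LayerSystem := List.ofFn triSystem ++ List.ofFn rhoSystem

/-- The neighbourhoods that determine a layer system. -/
def rigidNbhds : List (List Site) :=
  systems.flatMap fun S => S.steps.flatMap fun u => (S.steps.filter (· ≠ u)).map fun d => S.nbhd u d

/-- The neighbourhoods in the triangular lattice packings. -/
def latticeNbhds : List (List Site) :=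
  (List.ofFn triSystem).flatMap fun S => S.steps.map fun u => S.nbhd u u

/-- Every admissible set that contains `base` and has a pattern at each of the sites `hs` contains
one of the sets `goals`. -/
def forces (base hs : List Site) (goals : List (List Site)) : Bool :=
  resolves (goals.map (mask 2184)) (hs.map (bitIndex 1092)) (mask 2184 base)

/-- The unit vectors, followed by the sites at squared distance `2` from the origin. -/
def hintSites : List Site :=
  [![1, 0, 0], ![-1, 0, 0], ![0, 1, 0], ![0, -1, 0], ![0, 0, 1], ![0, 0, -1],
   ![1, 1, 0], ![1, -1, 0], ![-1, 1, 0], ![-1, -1, 0], ![1, 0, 1], ![1, 0, -1], ![-1, 0, 1],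
   ![-1, 0, -1], ![0, 1, 1], ![0, 1, -1], ![0, -1, 1], ![0, -1, -1]]

/-! ### Correctness of the bit mask encoding -/

theorem sqDist_eq_dot (x y : Site) : sqDist x y = dot (x - y) (x - y) := by
  simp [sqDist, dot, Fin.sum_univ_three, pow_two]

/-- All coordinates are at most `n` in absolute value. -/
def InCube (n : ℤ) (y : Site) : Prop := ∀ l, |y l| ≤ n

instance (n : ℤ) (y : Site) : Decidable (InCube n y) := inferInstanceAs (Decidable (∀ _, _))

theorem InCube.add {m n : ℤ} {x y : Site} (hx : InCube m x) (hy : InCube n y) :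
    InCube (m + n) (x + y) := fun l =>
  (abs_add_le _ _).trans (add_le_add (hx l) (hy l))

theorem InCube.mono {m n : ℤ} {x : Site} (hx : InCube m x) (h : m ≤ n) : InCube n x := fun l =>
  (hx l).trans h

theorem InCube.bounds {n : ℤ} {x : Site} (hx : InCube n x) :
    (-n ≤ x 0 ∧ x 0 ≤ n) ∧ (-n ≤ x 1 ∧ x 1 ≤ n) ∧ -n ≤ x 2 ∧ x 2 ≤ n :=
  ⟨abs_le.1 (hx 0), abs_le.1 (hx 1), abs_le.1 (hx 2)⟩

theorem site_ext {x y : Site} (h₀ : x 0 = y 0) (h₁ : x 1 = y 1) (h₂ : x 2 = y 2) : x = y := by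
  funext l
  fin_cases l <;> assumption

theorem testBit_mask (o : ℤ) (l : List Site) (i : ℕ) :
    (mask o l).testBit i = true ↔ ∃ y ∈ l, bitIndex o y = i := by
  induction l with
  | nil => simp [mask]
  | cons a l ih =>
    have : mask o (a :: l) = 1 <<< bitIndex o a ||| mask o l := rfl
    rw [this, Nat.testBit_or, Bool.or_eq_true, ih, Nat.one_shiftLeft, Nat.testBit_two_pow]
    simp

theorem testBit_conflictMask (l : List Site) (i : ℕ) :
    (conflictMask l).testBit i = true ↔
      ∃ q ∈ l, (nearMask <<< bitIndex 546 q).testBit i = true := by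
  induction l with
  | nil => simp [conflictMask]
  | cons a l ih =>
    have : conflictMask (a :: l) = nearMask <<< bitIndex 546 a ||| conflictMask l := rfl
    rw [this, Nat.testBit_or, Bool.or_eq_true, ih]
    simp

theorem exists_testBit_of_ne_zero {n : ℕ} (h : n ≠ 0) : ∃ i, n.testBit i = true := by
  by_contra! H
  exact h (Nat.eq_of_testBit_eq fun i => by simpa using H i)

/-- The offset 2184 = 8 · (1 + 16 + 256) turns coordinates in [-7, 7] into base 16 digits between 1
and 15. -/
theorem bitIndex_inj {x y : Site} (hx : InCube 7 x) (hy : InCube 7 y)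
    (h : bitIndex 2184 x = bitIndex 2184 y) : x = y := by
  have hx := hx.bounds
  have hy := hy.bounds
  unfold bitIndex at h
  apply site_ext <;> omega

/-- As 273 = 1 + 16 + 256, an offset of at least 273n keeps the indices of the cube [-n, n]³
nonnegative; nothing is truncated and shifting a mask translates its sites. -/
theorem bitIndex_add {m n o k : ℤ} {x y : Site} (hx : InCube m x) (hy : InCube n y)
    (ho : 273 * m ≤ o) (hk : 273 * n ≤ k) :
    bitIndex o x + bitIndex k y = bitIndex (o + k) (x + y) := by
  have hx := hx.bounds
  have hy := hy.bounds
  simp only [bitIndex, Pi.add_apply]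
  omega

/-- All the bits of `occ` stand for sites of `φ`. -/
def Marked (φ : Set Site) (occ : ℕ) : Prop :=
  ∀ i, occ.testBit i = true → ∃ y ∈ φ, InCube 7 y ∧ bitIndex 2184 y = i

theorem Marked.or {φ : Set Site} {m n : ℕ} (hm : Marked φ m) (hn : Marked φ n) :
    Marked φ (m ||| n) := fun i hi => by
  rw [Nat.testBit_or, Bool.or_eq_true] at hi
  exact hi.elim (hm i) (hn i)

theorem marked_mask {φ : Set Site} {l : List Site} (h : ∀ y ∈ l, y ∈ φ) (h' : ∀ y ∈ l, InCube 7 y) :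
    Marked φ (mask 2184 l) := fun i hi => by
  obtain ⟨y, hy, rfl⟩ := (testBit_mask _ _ _).1 hi
  exact ⟨y, h y hy, h' y hy, rfl⟩

theorem Marked.mem {φ : Set Site} {occ : ℕ} (h : Marked φ occ) {y : Site} (hy : InCube 7 y)
    (hb : occ.testBit (bitIndex 2184 y) = true) : y ∈ φ := by
  obtain ⟨z, hz, hz', e⟩ := h _ hb
  rwa [← bitIndex_inj hz' hy e]

theorem inCube_of_mem_ballSites : ∀ q ∈ ballSites, InCube 2 q := by decide +kernel

theorem tail_ballSites : ∀ q ∈ ballSites.tail, q ≠ 0 ∧ dot q q < 6 ∧ InCube 2 q := by decide +kernel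

theorem Marked.exists_near {φ : Set Site} {occ : ℕ} (h : Marked φ occ) {p : Site} (hp : InCube 5 p)
    (hc : nearMask <<< bitIndex 1638 p &&& occ ≠ 0) : ∃ q ∈ ballSites.tail, p + q ∈ φ := by
  obtain ⟨i, hi⟩ := exists_testBit_of_ne_zero hc
  rw [Nat.testBit_and, Bool.and_eq_true, Nat.testBit_shiftLeft, Bool.and_eq_true,
    decide_eq_true_eq, nearMask, testBit_mask] at hi
  obtain ⟨⟨hle, q, hq, e⟩, ho⟩ := hi
  have hs := (tail_ballSites q hq).2.2
  refine ⟨q, hq, h.mem ((hp.add hs).mono (by norm_num)) ?_⟩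
  have := bitIndex_add hp hs (o := 1638) (k := 546) (by norm_num) (by norm_num)
  norm_num at this
  rwa [← this, e, Nat.add_sub_cancel' hle]

theorem Admissible.eq_of_dot_lt {d : ℤ} {φ : Set Site} (hφ : Admissible d φ) {x y : Site}
    (hx : x ∈ φ) (hy : y ∈ φ) (h : dot (x - y) (x - y) < d) : x = y := by
  by_contra hne
  have : d ≤ sqDist x y := hφ hx hy hne
  rw [sqDist_eq_dot] at this
  omega

theorem Admissible.land_eq_zero {φ : Set Site} (hφ : Admissible 6 φ) {occ : ℕ} (h : Marked φ occ)
    {p : Site} (hp : InCube 5 p) (hpφ : p ∈ φ) : nearMask <<< bitIndex 1638 p &&& occ = 0 := by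
  by_contra hc
  obtain ⟨q, hq, hpq⟩ := h.exists_near hp hc
  obtain ⟨h0, h6, -⟩ := tail_ballSites q hq
  refine h0 ?_
  have := hφ.eq_of_dot_lt hpq hpφ (by simpa using h6)
  simpa using this

/-! ### Soundness of the search over patterns -/

/-- Around every site there is one of the patterns. -/
def Patterned (φ : Set Site) : Prop := ∀ x, ∃ P ∈ patterns, ∀ p ∈ P, x + p ∈ φ

theorem inCube_of_mem_patterns : ∀ P ∈ patterns, ∀ p ∈ P, InCube 2 p := by decide +kernel

/-- Follow the branch of the pattern that `φ` really has at each site. Admissibility keeps this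
branch from being discarded, and `occ` marks only sites of `φ` along it, so the goal reached at its
end consists of sites of `φ`. -/
theorem resolves_sound {φ : Set Site} (hφ : Admissible 6 φ) (hP : Patterned φ) (goals : List ℕ)
    (hs : List Site) (hsmall : ∀ x ∈ hs, InCube 3 x) (occ : ℕ) (hocc : Marked φ occ)
    (h : resolves goals (hs.map (bitIndex 1092)) occ = true) :
    ∃ g ∈ goals, ∃ n, Marked φ n ∧ g &&& n = g := by
  induction hs generalizing occ with
  | nil =>
    simp only [resolves, List.map_nil, Bool.or_false, List.any_eq_true, Nat.beq_eq] at h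
    obtain ⟨g, hg, e⟩ := h
    exact ⟨g, hg, occ, hocc, e⟩
  | cons x hs ih =>
    rw [List.map_cons, resolves, Bool.or_eq_true] at h
    rcases h with h | h
    · simp only [List.any_eq_true, Nat.beq_eq] at h
      obtain ⟨g, hg, e⟩ := h
      exact ⟨g, hg, occ, hocc, e⟩
    · obtain ⟨Q, hQ, hQφ⟩ := hP x
      have hQs := inCube_of_mem_patterns Q hQ
      obtain ⟨⟨q, Ps⟩, hq, hQ⟩ := List.mem_flatMap.1 hQ
      obtain ⟨P, hPs, rfl⟩ := List.mem_map.1 hQ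
      have hx := hsmall x (by simp)
      have key : ∀ p ∈ q :: P, nearMask <<< bitIndex 546 p <<< bitIndex 1092 x &&& occ = 0 := by
        intro p hp
        have := bitIndex_add (hQs p hp) hx (o := 546) (k := 1092) (by norm_num) (by norm_num)
        rw [← Nat.shiftLeft_add, this, add_comm p]
        exact hφ.land_eq_zero hocc ((hx.add (hQs p hp)).mono (by norm_num)) (hQφ p hp)
      rw [List.all_eq_true] at h
      have h1 := h _ hq
      rw [Bool.or_eq_true, key q (by simp)] at h1
      have h2 := List.all_eq_true.1 (h1.resolve_left (by simp)) P hPs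
      have h3 : conflictMask P <<< bitIndex 1092 x &&& occ = 0 := by
        by_contra hc
        obtain ⟨i, hi⟩ := exists_testBit_of_ne_zero hc
        rw [Nat.testBit_and, Nat.testBit_shiftLeft, Bool.and_eq_true, Bool.and_eq_true,
          testBit_conflictMask] at hi
        obtain ⟨⟨hle, p, hp, hi⟩, ho⟩ := hi
        have := congrArg (Nat.testBit · i) (key p (by simp [hp]))
        rw [Nat.zero_testBit] at this
        simp only [Nat.testBit_and] at this
        rw [Nat.testBit_shiftLeft, hle, hi, ho] at this
        simp at this
      rw [Bool.or_eq_true, h3] at h2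
      refine ih (fun y hy => hsmall y (by simp [hy])) _ (Marked.or ?_ hocc)
        (h2.resolve_left (by simp))
      intro i hi
      rw [Nat.testBit_shiftLeft, Bool.and_eq_true, decide_eq_true_eq, testBit_mask] at hi
      obtain ⟨hle, p, hp, e⟩ := hi
      refine ⟨x + p, hQφ p hp, (hx.add (hQs p hp)).mono (by norm_num), ?_⟩
      have := bitIndex_add hx (hQs p hp) (o := 1638) (k := 546) (by linarith) (by norm_num)
      have h4 : bitIndex 1638 x = bitIndex 1092 x + 546 := by
        have := hx.bounds
        simp only [bitIndex]
        omega
      norm_num at this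
      rw [← this, e, h4]
      omega

theorem forces_sound {φ : Set Site} (hφ : Admissible 6 φ) (hP : Patterned φ)
    {base hs : List Site} {goals : List (List Site)} (h : forces base hs goals = true)
    (hb : ∀ y ∈ base, InCube 7 y) (hhs : ∀ y ∈ hs, InCube 3 y)
    (hg : ∀ G ∈ goals, ∀ y ∈ G, InCube 7 y) (hbase : ∀ y ∈ base, y ∈ φ) :
    ∃ G ∈ goals, ∀ y ∈ G, y ∈ φ := by
  obtain ⟨g, hgg, n, hn, e⟩ := resolves_sound hφ hP _ hs hhs _ (marked_mask hbase hb) h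
  obtain ⟨G, hG, rfl⟩ := List.mem_map.1 hgg
  refine ⟨G, hG, fun y hy => hn.mem (hg G hG y hy) ?_⟩
  have := (testBit_mask 2184 G _).2 ⟨y, hy, rfl⟩
  rw [← e, Nat.testBit_and, Bool.and_eq_true] at this
  exact this.2

/-- The translate of a configuration that moves `x` to the origin. -/
theorem Admissible.preimage_add {d : ℤ} {φ : Set Site} (hφ : Admissible d φ) (x : Site) :
    Admissible d {z | x + z ∈ φ} := fun y hy z hz hne => by
  have : d ≤ sqDist (x + y) (x + z) := hφ hy hz (by simpa using hne)
  show d ≤ sqDist y z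
  rw [sqDist_eq_dot] at this ⊢
  simpa using this

theorem Patterned.preimage_add {φ : Set Site} (hφ : Patterned φ) (x : Site) :
    Patterned {z | x + z ∈ φ} := fun y => by
  obtain ⟨P, hP, h⟩ := hφ (x + y)
  exact ⟨P, hP, fun p hp => by simpa [add_assoc] using h p hp⟩

/-! ### The optimal potential and the patterns attaining it -/

open Classical in
/-- The total weight of the sites of `φ` in a list. -/
noncomputable def weightIn (φ : Set Site) (l : List Site) : ℕ :=
  (l.map fun p => if p ∈ φ then weight (dot p p) else 0).sum

theorem weightIn_cons_of_mem {φ : Set Site} {p : Site} (l : List Site) (hp : p ∈ φ) :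
    weightIn φ (p :: l) = weight (dot p p) + weightIn φ l := by simp [weightIn, hp]

theorem weightIn_cons_of_notMem {φ : Set Site} {p : Site} (l : List Site) (hp : p ∉ φ) :
    weightIn φ (p :: l) = weightIn φ l := by simp [weightIn, hp]

theorem weightIn_append (φ : Set Site) (l l' : List Site) :
    weightIn φ (l ++ l') = weightIn φ l + weightIn φ l' := by simp [weightIn]

theorem weightIn_eq_zero {φ : Set Site} {l : List Site} (h : ∀ p ∈ l, p ∉ φ) :
    weightIn φ l = 0 := by
  induction l with
  | nil => rfl
  | cons a l ih =>
    rw [weightIn_cons_of_notMem l (h a (by simp)), ih fun p hp => h p (by simp [hp])]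

/-- The sites of a list are in conflict with each other. -/
def IsConflictList (g : List Site) : Prop := g.Pairwise fun p q => p ≠ q ∧ dot (p - q) (p - q) < 6

instance (g : List Site) : Decidable (IsConflictList g) := inferInstanceAs (Decidable (g.Pairwise _))

theorem isConflictList_cliques : ∀ g ∈ cliques, IsConflictList g := by decide +kernel

/-- A clique contains at most one occupied site. -/
theorem weightIn_clique {φ : Set Site} (hφ : Admissible 6 φ) {g : List Site}
    (hg : IsConflictList g) :
    weightIn φ g = 0 ∨ ∃ p ∈ g, p ∈ φ ∧ weightIn φ g = weight (dot p p) := by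
  induction g with
  | nil => exact .inl rfl
  | cons a g ih =>
    obtain ⟨ha, hg⟩ := List.pairwise_cons.1 hg
    by_cases h : a ∈ φ
    · refine .inr ⟨a, by simp, h, ?_⟩
      rw [weightIn_cons_of_mem g h, weightIn_eq_zero, add_zero]
      intro p hp hpφ
      exact (ha p hp).1 (hφ.eq_of_dot_lt h hpφ (ha p hp).2)
    · rw [weightIn_cons_of_notMem g h]
      rcases ih hg with h0 | ⟨p, hp, h'⟩
      · exact .inl h0
      · exact .inr ⟨p, by simp [hp], h'⟩

theorem weight_le_of_mem {g : List Site} {p : Site} (hp : p ∈ g) :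
    weight (dot p p) ≤ g.foldr (fun p k => max (weight (dot p p)) k) 0 := by
  induction g with
  | nil => simp at hp
  | cons a g ih =>
    rcases List.mem_cons.1 hp with rfl | hp
    · exact le_max_left _ _
    · exact (ih hp).trans (le_max_right _ _)

theorem weightIn_le_weightBound {φ : Set Site} (hφ : Admissible 6 φ) {gs : List (List Site)}
    (hgs : ∀ g ∈ gs, IsConflictList g) : weightIn φ gs.flatten ≤ weightBound gs := by
  induction gs with
  | nil => exact le_rfl
  | cons g gs ih =>
    rw [List.flatten_cons, weightIn_append]
    refine add_le_add ?_ (ih fun g' hg' => hgs g' (by simp [hg']))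
    rcases weightIn_clique hφ (hgs g (by simp)) with h | ⟨p, hp, -, h⟩
    · omega
    · rw [h]
      exact weight_le_of_mem hp

/-- The branch to follow takes from each clique the site occupied in `φ`, if any. At a leaf of total
24 the mask equals that of a pattern, so the marked sites supply the whole pattern. -/
theorem boundedBy_sound {φ : Set Site} (hφ : Admissible 6 φ) (gs : List (List Site))
    (hgs : ∀ g ∈ gs, IsConflictList g ∧ ∀ p ∈ g, InCube 2 p) (occ tot : ℕ) (hocc : Marked φ occ)
    (h : boundedBy gs occ tot = true) :
    tot + weightIn φ gs.flatten ≤ 24 ∧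
      (tot + weightIn φ gs.flatten = 24 → ∃ P ∈ patterns, ∀ p ∈ P, p ∈ φ) := by
  induction gs generalizing occ tot with
  | nil =>
    simp only [boundedBy, Bool.or_eq_true, Nat.blt_eq, Bool.and_eq_true, Nat.beq_eq] at h
    have h0 : weightIn φ ([] : List (List Site)).flatten = 0 := rfl
    refine ⟨by omega, fun ht => ?_⟩
    obtain ⟨-, h⟩ := h.resolve_left (by omega)
    obtain ⟨P, hP, e⟩ := List.any_eq_true.1 h
    rw [Nat.beq_eq] at e
    refine ⟨P, hP, fun p hp => hocc.mem ((inCube_of_mem_patterns P hP p hp).mono (by norm_num)) ?_⟩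
    rw [← e, testBit_mask]
    exact ⟨p, hp, rfl⟩
  | cons g gs ih =>
    have hg := hgs g (by simp)
    have hgs' : ∀ g ∈ gs, IsConflictList g ∧ ∀ p ∈ g, InCube 2 p := fun g' hg' =>
      hgs g' (by simp [hg'])
    rw [boundedBy, Bool.or_eq_true, Nat.blt_eq, Bool.and_eq_true] at h
    rcases h with h | ⟨h, h'⟩
    · have := weightIn_le_weightBound hφ fun g' hg' => (hgs g' hg').1
      exact ⟨by omega, fun _ => by omega⟩
    · rw [List.flatten_cons, weightIn_append]
      rcases weightIn_clique hφ hg.1 with h0 | ⟨p, hp, hpφ, h0⟩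
      · rw [h0, zero_add]
        exact ih hgs' occ tot hocc h
      · have h1 := List.all_eq_true.1 h' p hp
        rw [hφ.land_eq_zero hocc ((hg.2 p hp).mono (by norm_num)) hpφ, Bool.or_eq_true] at h1
        rw [h0, ← add_assoc]
        refine ih hgs' _ _ (Marked.or (fun i hi => ?_) hocc) (h1.resolve_left (by simp))
        rw [Nat.one_shiftLeft, Nat.testBit_two_pow, decide_eq_true_eq] at hi
        exact ⟨p, hpφ, (hg.2 p hp).mono (by norm_num), hi⟩

theorem boundedBy_cliques : boundedBy cliques 0 0 = true := by decide +kernel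

theorem weightIn_ballSites {φ : Set Site} (hφ : Admissible 6 φ) :
    weightIn φ ballSites ≤ 24 ∧
      (weightIn φ ballSites = 24 → ∃ P ∈ patterns, ∀ p ∈ P, p ∈ φ) := by
  have := boundedBy_sound hφ cliques
    (fun g hg => ⟨isConflictList_cliques g hg,
      fun p hp => inCube_of_mem_ballSites p (List.mem_flatten.2 ⟨g, hg, hp⟩)⟩) 0 0
    (fun i hi => by simp at hi) boundedBy_cliques
  rw [zero_add] at this
  exact this

theorem patterns_weight : ∀ P ∈ patterns, P.Nodup ∧ (∀ p ∈ P, p ∈ ballSites) ∧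
    (P.map fun p => weight (dot p p)).sum = 24 := by decide +kernel

theorem nodup_ballSites : ballSites.Nodup := by decide +kernel

theorem mem_ballSites (q : Site) : q ∈ ballSites ↔ dot q q < 6 := by
  constructor
  · exact (by decide +kernel : ∀ q ∈ ballSites, dot q q < 6) q
  · intro h
    have key : ∀ a ∈ Finset.Icc (-2 : ℤ) 2, ∀ b ∈ Finset.Icc (-2 : ℤ) 2,
        ∀ c ∈ Finset.Icc (-2 : ℤ) 2, a * a + b * b + c * c < 6 → ![a, b, c] ∈ ballSites := by
      decide +kernel
    unfold dot at h
    have e : q = ![q 0, q 1, q 2] := site_ext rfl rfl rfl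
    rw [e]
    refine key _ (Finset.mem_Icc.2 ?_) _ (Finset.mem_Icc.2 ?_) _ (Finset.mem_Icc.2 ?_) h <;>
      constructor <;> nlinarith [mul_self_nonneg (q 0), mul_self_nonneg (q 1), mul_self_nonneg (q 2)]

theorem weightIn_eq_sum (φ : Set Site) (l : List Site) (hl : l.Nodup) :
    weightIn φ l = open Classical in ∑ p ∈ l.toFinset, if p ∈ φ then weight (dot p p) else 0 := by
  rw [weightIn, List.sum_toFinset _ hl]

theorem weightIn_of_pattern {φ : Set Site} {P : List Site} (hP : P ∈ patterns)
    (h : ∀ p ∈ P, p ∈ φ) : 24 ≤ weightIn φ ballSites := by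
  classical
  obtain ⟨hn, hb, hw⟩ := patterns_weight P hP
  have e : weightIn φ P = 24 := by
    rw [← hw, weightIn]
    congr 1
    exact List.map_congr_left fun p hp => if_pos (h p hp)
  rw [← e, weightIn_eq_sum _ _ hn, weightIn_eq_sum _ _ nodup_ballSites]
  exact Finset.sum_le_sum_of_subset fun p hp => by simpa using hb p (by simpa using hp)

theorem force_eq_weight (t : ℤ) : force t = (weight t : ℚ) / 24 := by
  unfold force weight
  split_ifs <;> norm_num

theorem ball_eq_image (x : Site) : ball x = ballSites.toFinset.image (x + ·) := by
  ext y
  rw [mem_ball, Finset.mem_image, sqDist_eq_dot]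
  constructor
  · intro h
    refine ⟨y - x, ?_, by simp⟩
    rw [List.mem_toFinset, mem_ballSites]
    simp only [dot, Pi.sub_apply] at h ⊢
    linarith
  · rintro ⟨q, hq, rfl⟩
    rw [List.mem_toFinset, mem_ballSites] at hq
    simp only [dot, Pi.sub_apply, Pi.add_apply] at hq ⊢
    linarith

/-- 288 = 12 · 24: the normalizing constant times the scaling of the weights. -/
theorem potential_eq (φ : Set Site) (x : Site) :
    potential φ x = (weightIn {z | x + z ∈ φ} ballSites : ℚ) / 288 := by
  classical
  rw [potential, ball_eq_image, Finset.sum_image (by simp), weightIn_eq_sum _ _ nodup_ballSites]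
  push_cast
  rw [Finset.mul_sum, Finset.sum_div]
  refine Finset.sum_congr rfl fun p _ => ?_
  have : sqDist x (x + p) = dot p p := by
    rw [sqDist_eq_dot]
    simp [dot]
  rw [this, force_eq_weight]
  by_cases h : x + p ∈ φ
  · rw [if_pos h, if_pos (show p ∈ {z | x + z ∈ φ} from h)]
    ring
  · rw [if_neg h, if_neg (show p ∉ {z | x + z ∈ φ} from h)]
    simp

theorem potential_le {φ : Set Site} (hφ : Admissible 6 φ) (x : Site) : potential φ x ≤ 1 / 12 := by
  have h : (weightIn {z | x + z ∈ φ} ballSites : ℚ) ≤ 24 := by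
    exact_mod_cast (weightIn_ballSites (hφ.preimage_add x)).1
  rw [potential_eq]
  linarith

theorem potential_singleton : potential {0} 0 = 1 / 12 := by
  classical
  rw [potential, Finset.sum_eq_single 0]
  · simp [sqDist, force]
  · intro y _ hy
    simp [hy]
  · intro h
    exact absurd ((mem_ball _ _).2 (by simp [sqDist])) h

theorem isPerfect_iff_potential (φ : Set Site) :
    IsPerfect φ ↔ Admissible 6 φ ∧ ∀ x, potential φ x = 1 / 12 := by
  refine and_congr_right fun _ => forall_congr' fun x => ⟨fun h => ?_, fun h => ?_⟩
  · obtain ⟨y, ψ, hψ, e⟩ := h.1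
    refine le_antisymm (e ▸ potential_le hψ y) (h.2 ⟨0, {0}, ?_, potential_singleton⟩)
    exact Set.pairwise_singleton _ _
  · rw [h]
    refine ⟨⟨0, {0}, Set.pairwise_singleton _ _, potential_singleton⟩, ?_⟩
    rintro t ⟨y, ψ, hψ, rfl⟩
    exact potential_le hψ y

theorem isPerfect_iff (φ : Set Site) : IsPerfect φ ↔ Admissible 6 φ ∧ Patterned φ := by
  rw [isPerfect_iff_potential]
  refine and_congr_right fun hφ => forall_congr' fun x => ?_
  have h := weightIn_ballSites (hφ.preimage_add x)
  rw [potential_eq]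
  constructor
  · intro e
    refine h.2 ?_
    have : (weightIn {z | x + z ∈ φ} ballSites : ℚ) = 24 := by linarith
    exact_mod_cast this
  · rintro ⟨P, hP, hPφ⟩
    have := le_antisymm h.1 (weightIn_of_pattern hP hPφ)
    rw [this]
    norm_num

/-- The pattern around a site `y` of `ψ` contains a particle of `φ` at distance less than √6 from
`y`; admissibility of `ψ` identifies the two. -/
theorem IsPerfect.eq_of_subset {φ ψ : Set Site} (hφ : IsPerfect φ) (hψ : Admissible 6 ψ)
    (h : φ ⊆ ψ) : φ = ψ := by
  refine h.antisymm fun y hy => ?_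
  obtain ⟨P, hP, hPφ⟩ := ((isPerfect_iff φ).1 hφ).2 y
  have hne : P ≠ [] := by
    rintro rfl
    simpa using (patterns_weight _ hP).2.2
  obtain ⟨p, hp⟩ := List.exists_mem_of_ne_nil P hne
  have hpy := hPφ p hp
  have : y + p = y := hψ.eq_of_dot_lt (h hpy) hy (by
    simpa using (mem_ballSites p).1 ((patterns_weight P hP).2.1 p hp))
  rwa [this] at hpy

/-! ### The lattice of a layer system -/

theorem dot_add (u v w : Site) : dot u (v + w) = dot u v + dot u w := by
  simp only [dot, Pi.add_apply]
  ring

theorem dot_sub (u v w : Site) : dot u (v - w) = dot u v - dot u w := by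
  simp only [dot, Pi.sub_apply]
  ring

theorem dot_neg (u v : Site) : dot u (-v) = -dot u v := by
  simp only [dot, Pi.neg_apply]
  ring

theorem dot_zsmul (u : Site) (n : ℤ) (v : Site) : dot u (n • v) = n * dot u v := by
  simp only [dot, Pi.smul_apply, smul_eq_mul]
  ring

theorem mem_systems {S : LayerSystem} :
    S ∈ systems ↔ (∃ i, S = triSystem i) ∨ ∃ i, S = rhoSystem i := by
  rw [systems, List.mem_append, List.mem_ofFn, List.mem_ofFn]
  simp only [eq_comm]

namespace LayerSystem

variable {S : LayerSystem}

theorem lat_zero : S.Lat 0 := by simp [Lat, dot]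

theorem Lat.add {y z : Site} (hy : S.Lat y) (hz : S.Lat z) : S.Lat (y + z) := by
  refine ⟨?_, ?_⟩ <;> rw [dot_add]
  · rw [hy.1, hz.1, add_zero]
  · exact dvd_add hy.2 hz.2

theorem Lat.neg {z : Site} (hz : S.Lat z) : S.Lat (-z) := by
  refine ⟨?_, ?_⟩ <;> rw [dot_neg]
  · rw [hz.1, neg_zero]
  · exact hz.2.neg_right

theorem Lat.sub {y z : Site} (hy : S.Lat y) (hz : S.Lat z) : S.Lat (y - z) := by
  rw [sub_eq_add_neg]
  exact hy.add hz.neg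

theorem Lat.zsmul {z : Site} (hz : S.Lat z) (n : ℤ) : S.Lat (n • z) := by
  refine ⟨?_, ?_⟩ <;> rw [dot_zsmul]
  · rw [hz.1, mul_zero]
  · exact hz.2.mul_left n

theorem mem_star {u v : Site} : v ∈ S.star u ↔ v ∈ shell ∧ S.Lat (v - u) := by
  simp [star]

theorem lat_gens : ∀ S ∈ systems, ∀ g ∈ S.gens, S.Lat g ∧ g ∈ S.star 0 ∧ InCube 2 g := by
  decide +kernel

theorem inCube_steps : ∀ S ∈ systems, ∀ u ∈ S.steps, dot S.s u = S.h ∧ InCube 2 u := by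
  decide +kernel

theorem Lat.exists_coeff (hS : S ∈ systems) {z : Site} (hz : S.Lat z) :
    ∃ a b : ℤ, z = a • S.g₁ + b • S.g₂ := by
  obtain ⟨h, t, ht⟩ := hz
  -- On a·g₁ + b·g₂ the functional `c` takes the value m·a and `e` the value a - b.
  refine ⟨t, t - dot S.e z, ?_⟩
  rcases mem_systems.1 hS with ⟨i, rfl⟩ | ⟨i, rfl⟩
  · fin_cases i <;> simp [triSystem, mainSign, dot] at h ht ⊢ <;> apply site_ext <;> simp <;> omega
  · fin_cases i <;> simp [rhoSystem, rhoSystemOf, dot] at h ht ⊢ <;> apply site_ext <;>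
      simp <;> omega

end LayerSystem

theorem forall_add_zsmul {P : Site → Prop} {g : Site} (h : ∀ z, P z → P (z + g))
    (h' : ∀ z, P z → P (z + -g)) {z : Site} (hz : P z) (n : ℤ) : P (z + n • g) := by
  induction n using Int.induction_on with
  | zero => simpa using hz
  | succ k ih => simpa [add_smul, add_assoc] using h _ ih
  | pred k ih => 
    rw [sub_smul, one_smul, sub_eq_add_neg, ← add_assoc]
    exact h' _ ih

theorem LayerSystem.Lat.induction {S : LayerSystem} (hS : S ∈ systems) {P : Site → Prop} {x : Site}
    (hx : P x) (h : ∀ z, ∀ g ∈ S.gens, P z → P (z + g)) {z : Site} (hz : S.Lat z) : P (x + z) := by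
  obtain ⟨a, b, rfl⟩ := hz.exists_coeff hS
  rw [← add_assoc]
  exact forall_add_zsmul (fun z => h z S.g₂ (by simp [gens])) (fun z => h z (-S.g₂) (by simp [gens]))
    (forall_add_zsmul (fun z => h z S.g₁ (by simp [gens])) (fun z => h z (-S.g₁) (by simp [gens]))
      hx a) b

/-! ### Local forcing rules and complete layers -/

theorem inCube_shell : ∀ v ∈ shell, InCube 2 v := by decide +kernel

theorem inCube_hintSites : ∀ v ∈ hintSites, InCube 1 v := by decide +kernel

theorem LayerSystem.inCube_star {S : LayerSystem} {u v : Site} (h : v ∈ S.star u) : InCube 2 v :=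
  inCube_shell v (mem_star.1 h).1

theorem LayerSystem.inCube_nbhd {S : LayerSystem} {u d v : Site} (h : v ∈ S.nbhd u d) :
    InCube 2 v := by
  rw [nbhd, List.mem_append, List.mem_append] at h
  rcases h with (h | h) | h <;> exact inCube_star h

theorem mem_rigidNbhds {G : List Site} : G ∈ rigidNbhds ↔
    ∃ S ∈ systems, ∃ u ∈ S.steps, ∃ d ∈ S.steps, d ≠ u ∧ S.nbhd u d = G := by
  simp [rigidNbhds, and_assoc]

theorem mem_latticeNbhds {G : List Site} : G ∈ latticeNbhds ↔
    ∃ i, ∃ u ∈ (triSystem i).steps, (triSystem i).nbhd u u = G := by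
  simp only [latticeNbhds, List.mem_flatMap, List.mem_ofFn, List.mem_map,
    exists_exists_eq_and]

theorem inCube_of_mem_nbhds {G : List Site} (h : G ∈ rigidNbhds ++ latticeNbhds) {v : Site}
    (hv : v ∈ G) : InCube 2 v := by
  rcases List.mem_append.1 h with h | h
  · obtain ⟨S, -, u, -, d, -, -, rfl⟩ := mem_rigidNbhds.1 h
    exact LayerSystem.inCube_nbhd hv
  · obtain ⟨i, u, -, rfl⟩ := mem_latticeNbhds.1 h
    exact LayerSystem.inCube_nbhd hv

/-- The starting point of rigidity. Rhombic neighbourhoods with equal steps need no goal of their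
own: the search always reaches one of the listed goals. -/
theorem forces_nbhd : forces [0] hintSites (rigidNbhds ++ latticeNbhds) = true := by
  decide +kernel

theorem forces_rigid : (systems.all fun S => S.steps.all fun u =>
    (S.steps.filter (· ≠ u)).all fun d => S.gens.all fun g =>
      forces (0 :: S.nbhd u d) (hintSites.map (g + ·)) [(S.nbhd u d).map (g + ·)]) = true := by
  decide +kernel

/-- Equal steps are less rigid: the neighbour may have a neighbourhood with unequal steps, possibly
of another layer system. This is why those are admitted as goals. -/
theorem forces_lattice : ((List.ofFn triSystem).all fun S => S.steps.all fun u =>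
    S.gens.all fun g => forces (0 :: S.nbhd u u) (hintSites.map (g + ·))
      ((S.nbhd u u :: rigidNbhds).map fun G => G.map (g + ·))) = true := by
  decide +kernel

/-- The first search finds a particle one step above (or below) a layer; the second carries the same
step over to the neighbours of the starting site in its layer. -/
theorem forces_step : (systems.all fun S => [S.steps, S.steps.map (-·)].all fun us =>
    forces (0 :: S.star 0) hintSites (us.map ([·])) &&
      us.all fun u => S.gens.all fun g =>
        forces ([0, g, u] ++ S.star 0 ++ (S.star 0).map (g + ·)) (hintSites.map (g + ·))
          [[g + u]]) = true := by
  decide +kernel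

theorem inCube_zero {n : ℤ} (hn : 0 ≤ n) : InCube n 0 := fun l => by simpa using hn

theorem inCube_add_hintSites {g : Site} (hg : InCube 2 g) :
    ∀ y ∈ hintSites.map (g + ·), InCube 3 y := by
  intro y hy
  obtain ⟨v, hv, rfl⟩ := List.mem_map.1 hy
  exact (hg.add (inCube_hintSites v hv)).mono (by norm_num)

theorem inCube_map_add {g : Site} (hg : InCube 2 g) {G : List Site} (hG : ∀ v ∈ G, InCube 2 v) :
    ∀ y ∈ G.map (g + ·), InCube 7 y := by
  intro y hy
  obtain ⟨v, hv, rfl⟩ := List.mem_map.1 hy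
  exact (hg.add (hG v hv)).mono (by norm_num)

theorem InCube.neg {n : ℤ} {x : Site} (hx : InCube n x) : InCube n (-x) := fun l => by
  simpa using hx l

/-- The forcing rules, at an arbitrary site. -/
theorem IsPerfect.forces {φ : Set Site} (hφ : IsPerfect φ) (x : Site) {base hs : List Site}
    {goals : List (List Site)} (h : forces base hs goals = true) (hb : ∀ y ∈ base, InCube 7 y)
    (hhs : ∀ y ∈ hs, InCube 3 y) (hg : ∀ G ∈ goals, ∀ y ∈ G, InCube 7 y)
    (hbase : ∀ y ∈ base, x + y ∈ φ) : ∃ G ∈ goals, ∀ y ∈ G, x + y ∈ φ :=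
  have hφ := (isPerfect_iff φ).1 hφ
  forces_sound (hφ.1.preimage_add x) (hφ.2.preimage_add x) h hb hhs hg hbase

theorem IsPerfect.exists_nbhd {φ : Set Site} (hφ : IsPerfect φ) {x : Site} (hx : x ∈ φ) :
    ∃ G ∈ rigidNbhds ++ latticeNbhds, ∀ v ∈ G, x + v ∈ φ :=
  hφ.forces x forces_nbhd (by simpa using inCube_zero (by norm_num))
    (fun y hy => (inCube_hintSites y hy).mono (by norm_num))
    (fun G hG y hy => (inCube_of_mem_nbhds hG hy).mono (by norm_num)) (by simpa using hx)

namespace LayerSystem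

variable {S : LayerSystem} {φ : Set Site}

theorem rigid_spread (hS : S ∈ systems) (hφ : IsPerfect φ) {u d g x : Site}
    (hu : u ∈ S.steps) (hd : d ∈ S.steps) (hne : d ≠ u) (hg : g ∈ S.gens) (hx : x ∈ φ)
    (h : ∀ v ∈ S.nbhd u d, x + v ∈ φ) : ∀ v ∈ S.nbhd u d, x + g + v ∈ φ := by
  have h1 := List.all_eq_true.1 (List.all_eq_true.1 (List.all_eq_true.1 (List.all_eq_true.1
    forces_rigid S hS) u hu) d (List.mem_filter.2 ⟨hd, by simpa using hne⟩)) g hg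
  have hg2 := (lat_gens S hS g hg).2.2
  obtain ⟨G, hG, hGφ⟩ := hφ.forces x h1
    (by
      intro y hy
      rcases List.mem_cons.1 hy with rfl | hy
      · exact inCube_zero (by norm_num)
      · exact (inCube_nbhd hy).mono (by norm_num))
    (inCube_add_hintSites hg2)
    (by
      intro G hG
      rw [List.mem_singleton.1 hG]
      exact inCube_map_add hg2 fun v hv => inCube_nbhd hv)
    (by
      intro y hy
      rcases List.mem_cons.1 hy with rfl | hy
      · simpa using hx
      · exact h y hy)
  rw [List.mem_singleton.1 hG] at hGφ
  intro v hv
  rw [add_assoc]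
  exact hGφ _ (List.mem_map.2 ⟨v, hv, rfl⟩)

theorem lattice_spread (hφ : IsPerfect φ) (i : Fin 4) {u g x : Site}
    (hu : u ∈ (triSystem i).steps) (hg : g ∈ (triSystem i).gens) (hx : x ∈ φ)
    (h : ∀ v ∈ (triSystem i).nbhd u u, x + v ∈ φ) :
    (∀ v ∈ (triSystem i).nbhd u u, x + g + v ∈ φ) ∨
      ∃ G ∈ rigidNbhds, ∀ v ∈ G, x + g + v ∈ φ := by
  have h1 := List.all_eq_true.1 (List.all_eq_true.1 (List.all_eq_true.1
    forces_lattice _ (List.mem_ofFn.2 ⟨i, rfl⟩)) u hu) g hg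
  have hg2 := (lat_gens _ (mem_systems.2 (.inl ⟨i, rfl⟩)) g hg).2.2
  obtain ⟨G, hG, hGφ⟩ := hφ.forces x h1
    (by
      intro y hy
      rcases List.mem_cons.1 hy with rfl | hy
      · exact inCube_zero (by norm_num)
      · exact (inCube_nbhd hy).mono (by norm_num))
    (inCube_add_hintSites hg2)
    (by
      intro G hG
      obtain ⟨G, hG', rfl⟩ := List.mem_map.1 hG
      refine inCube_map_add hg2 fun v hv => ?_
      rcases List.mem_cons.1 hG' with rfl | hG'
      · exact inCube_nbhd hv
      · exact inCube_of_mem_nbhds (List.mem_append_left _ hG') hv)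
    (by
      intro y hy
      rcases List.mem_cons.1 hy with rfl | hy
      · simpa using hx
      · exact h y hy)
  obtain ⟨G, hG', rfl⟩ := List.mem_map.1 hG
  have hGφ : ∀ v ∈ G, x + g + v ∈ φ := fun v hv => by
    rw [add_assoc]
    exact hGφ _ (List.mem_map.2 ⟨v, hv, rfl⟩)
  rcases List.mem_cons.1 hG' with rfl | hG'
  · exact .inl hGφ
  · exact .inr ⟨G, hG', hGφ⟩

/-- The layer through `x` is contained in `φ`. -/
def HasLayer (S : LayerSystem) (φ : Set Site) (x : Site) : Prop := ∀ z, S.Lat z → x + z ∈ φ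

theorem HasLayer.mem {x : Site} (h : S.HasLayer φ x) : x ∈ φ := by
  simpa using h 0 lat_zero

theorem mem_nbhd_of_mem_gens (hS : S ∈ systems) {g : Site} (hg : g ∈ S.gens) (u d : Site) :
    g ∈ S.nbhd u d :=
  List.mem_append_left _ (List.mem_append_left _ (lat_gens S hS g hg).2.1)

theorem hasLayer_of_rigid (hS : S ∈ systems) (hφ : IsPerfect φ) {u d x : Site}
    (hu : u ∈ S.steps) (hd : d ∈ S.steps) (hne : d ≠ u) (hx : x ∈ φ)
    (h : ∀ v ∈ S.nbhd u d, x + v ∈ φ) : S.HasLayer φ x := by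
  intro z hz
  refine (Lat.induction hS (P := fun y => y ∈ φ ∧ ∀ v ∈ S.nbhd u d, y + v ∈ φ) ⟨hx, h⟩ ?_ hz).1
  exact fun y g hg hy => ⟨hy.2 g (mem_nbhd_of_mem_gens hS hg u d),
    rigid_spread hS hφ hu hd hne hg hy.1 hy.2⟩

/-- One rigid neighbourhood anywhere produces a layer by spreading. -/
theorem exists_hasLayer (hφ : IsPerfect φ) : ∃ S ∈ systems, ∃ x, S.HasLayer φ x := by
  by_cases H : ∃ x ∈ φ, ∃ G ∈ rigidNbhds, ∀ v ∈ G, x + v ∈ φ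
  · obtain ⟨x, hx, G, hG, h⟩ := H
    obtain ⟨S, hS, u, hu, d, hd, hne, rfl⟩ := mem_rigidNbhds.1 hG
    exact ⟨S, hS, x, hasLayer_of_rigid hS hφ hu hd hne hx h⟩
  -- With no rigid neighbourhood at all, the second alternative of `lattice_spread` is void, so the
  -- same `i` and `u` persist along the layer.
  · push Not at H
    obtain ⟨P, hP, hPφ⟩ := ((isPerfect_iff φ).1 hφ).2 0
    have hne : P ≠ [] := by
      rintro rfl
      simpa using (patterns_weight _ hP).2.2
    obtain ⟨x, hx⟩ := List.exists_mem_of_ne_nil P hne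
    have hx := hPφ x hx
    rw [zero_add] at hx
    obtain ⟨G, hG, h⟩ := hφ.exists_nbhd hx
    have hG : G ∈ latticeNbhds := (List.mem_append.1 hG).resolve_left fun hG => by
      obtain ⟨v, hv, hv'⟩ := H x hx G hG
      exact hv' (h v hv)
    obtain ⟨i, u, hu, rfl⟩ := mem_latticeNbhds.1 hG
    have hS : triSystem i ∈ systems := mem_systems.2 (.inl ⟨i, rfl⟩)
    refine ⟨triSystem i, hS, x, fun z hz => ?_⟩
    refine (Lat.induction hS (P := fun y => y ∈ φ ∧ ∀ v ∈ (triSystem i).nbhd u u, y + v ∈ φ)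
      ⟨hx, h⟩ (fun y g hg hy => ?_) hz).1
    have hyg := hy.2 g (mem_nbhd_of_mem_gens hS hg u u)
    refine ⟨hyg, (lattice_spread hφ i hu hg hy.1 hy.2).resolve_right ?_⟩
    rintro ⟨G, hG, hv⟩
    obtain ⟨v, hv1, hv2⟩ := H _ hyg G hG
    exact hv2 (hv v hv1)

theorem HasLayer.exists_step (hS : S ∈ systems) (hφ : IsPerfect φ) {us : List Site}
    (hus : us ∈ [S.steps, S.steps.map (-·)]) {x : Site} (hx : S.HasLayer φ x) :
    ∃ u ∈ us, S.HasLayer φ (x + u) := by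
  have h1 := List.all_eq_true.1 (List.all_eq_true.1 forces_step S hS) us hus
  rw [Bool.and_eq_true] at h1
  have hsmall : ∀ u ∈ us, InCube 2 u := by
    intro u hu
    rcases List.mem_cons.1 hus with rfl | hus
    · exact (inCube_steps S hS u hu).2
    · rw [List.mem_singleton.1 hus] at hu
      obtain ⟨v, hv, rfl⟩ := List.mem_map.1 hu
      exact (inCube_steps S hS v hv).2.neg
  have hstar : ∀ v ∈ S.star 0, S.Lat v := fun v hv => by simpa using (mem_star.1 hv).2
  obtain ⟨G, hG, hGφ⟩ := hφ.forces x h1.1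
    (by
      intro y hy
      rcases List.mem_cons.1 hy with rfl | hy
      · exact inCube_zero (by norm_num)
      · exact (inCube_star hy).mono (by norm_num))
    (fun y hy => (inCube_hintSites y hy).mono (by norm_num))
    (by
      intro G hG y hy
      obtain ⟨u, hu, rfl⟩ := List.mem_map.1 hG
      rw [List.mem_singleton.1 hy]
      exact (hsmall u hu).mono (by norm_num))
    (by
      intro y hy
      rcases List.mem_cons.1 hy with rfl | hy
      · simpa using hx.mem
      · exact hx y (hstar y hy))
  obtain ⟨u, hu, rfl⟩ := List.mem_map.1 hG
  have hxu : x + u ∈ φ := hGφ u (by simp)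
  refine ⟨u, hu, fun z hz => ?_⟩
  rw [add_right_comm]
  -- The full layer is kept in the induction hypothesis because the search needs the stars of both
  -- `y` and `y + g`.
  refine (Lat.induction hS (P := fun y => S.HasLayer φ y ∧ y + u ∈ φ) ⟨hx, hxu⟩ ?_ hz).2
  intro y g hg ⟨hy, hyu⟩
  have hlg := lat_gens S hS g hg
  have hyg : S.HasLayer φ (y + g) := fun z hz => by
    rw [add_assoc]
    exact hy _ (hlg.1.add hz)
  refine ⟨hyg, ?_⟩
  have h2 := List.all_eq_true.1 (List.all_eq_true.1 h1.2 u hu) g hg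
  obtain ⟨G, hG, hGφ⟩ := hφ.forces y h2
    (by
      intro v hv
      rw [List.mem_append, List.mem_append] at hv
      rcases hv with (hv | hv) | hv
      · simp only [List.mem_cons, List.not_mem_nil, or_false] at hv
        rcases hv with rfl | rfl | rfl
        · exact inCube_zero (by norm_num)
        · exact hlg.2.2.mono (by norm_num)
        · exact (hsmall _ hu).mono (by norm_num)
      · exact (inCube_star hv).mono (by norm_num)
      · exact inCube_map_add hlg.2.2 (fun _ h => inCube_star h) v hv)
    (inCube_add_hintSites hlg.2.2)
    (by
      intro G hG v hv
      rw [List.mem_singleton.1 hG, List.mem_singleton] at hv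
      rw [hv]
      exact (hlg.2.2.add (hsmall u hu)).mono (by norm_num))
    (by
      intro v hv
      rw [List.mem_append, List.mem_append] at hv
      rcases hv with (hv | hv) | hv
      · simp only [List.mem_cons, List.not_mem_nil, or_false] at hv
        rcases hv with rfl | rfl | rfl
        · simpa using hy.mem
        · exact hyg.mem
        · exact hyu
      · exact hy v (hstar v hv)
      · obtain ⟨w, hw, rfl⟩ := List.mem_map.1 hv
        exact hy _ (hlg.1.add (hstar w hw)))
  rw [List.mem_singleton.1 hG] at hGφ
  rw [add_assoc]
  exact hGφ _ (by simp)

end LayerSystem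

/-! ### From one layer to a full stack -/

theorem exists_int_path {P : Site → Prop} {us : List Site} (hup : ∀ x, P x → ∃ u ∈ us, P (x + u))
    (hdown : ∀ x, P x → ∃ u ∈ us, P (x - u)) {x : Site} (hx : P x) :
    ∃ p : ℤ → Site, p 0 = x ∧ ∀ k, P (p k) ∧ p (k + 1) - p k ∈ us := by
  choose f hf hf' using hup
  choose b hb hb' using hdown
  let F : {x // P x} → {x // P x} := fun x => ⟨x.1 + f x.1 x.2, hf' x.1 x.2⟩
  let B : {x // P x} → {x // P x} := fun x => ⟨x.1 - b x.1 x.2, hb' x.1 x.2⟩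
  -- Both formulas give `x` at index 0, so the upward and the downward iterations join there.
  let q : ℤ → {x // P x} := fun k => if 0 ≤ k then F^[k.toNat] ⟨x, hx⟩ else B^[(-k).toNat] ⟨x, hx⟩
  refine ⟨fun k => (q k).1, by simp [q], fun k => ⟨(q k).2, ?_⟩⟩
  by_cases hk : 0 ≤ k
  · have e : (k + 1).toNat = k.toNat + 1 := by omega
    have : q (k + 1) = F (q k) := by
      simp only [q, if_pos hk, if_pos (show 0 ≤ k + 1 by omega), e, Function.iterate_succ_apply']
    simp only [this, F, add_sub_cancel_left]
    exact hf _ _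
  · have e : (-k).toNat = (-(k + 1)).toNat + 1 := by omega
    have h1 : q (k + 1) = B^[(-(k + 1)).toNat] ⟨x, hx⟩ := by
      by_cases h0 : 0 ≤ k + 1
      · have : k + 1 = 0 := by omega
        simp [q, this]
      · simp only [q, if_neg h0]
    have : q k = B (q (k + 1)) := by
      rw [h1]
      simp only [q, if_neg hk, e, Function.iterate_succ_apply']
    simp only [this, B, sub_sub_cancel]
    exact hb _ _

namespace LayerSystem

/-- The union of the layers through the points `p k`. -/
def layers (S : LayerSystem) (p : ℤ → Site) : Set Site := {y | ∃ k, S.Lat (y - p k)}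

/-- Successive points differ by a step of the layer system. -/
def IsPath (S : LayerSystem) (p : ℤ → Site) : Prop := ∀ k, p (k + 1) - p k ∈ S.steps

end LayerSystem

theorem IsPerfect.exists_layers_subset {φ : Set Site} (hφ : IsPerfect φ) :
    ∃ S ∈ systems, ∃ p, S.IsPath p ∧ S.layers p ⊆ φ := by
  obtain ⟨S, hS, x, hx⟩ := LayerSystem.exists_hasLayer hφ
  obtain ⟨p, -, hp⟩ := exists_int_path (P := S.HasLayer φ) (us := S.steps)
    (fun y hy => hy.exists_step hS hφ (by simp))
    (fun y hy => by
      obtain ⟨u, hu, h⟩ := hy.exists_step hS hφ (us := S.steps.map (-·)) (by simp)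
      obtain ⟨v, hv, rfl⟩ := List.mem_map.1 hu
      exact ⟨v, hv, by rwa [sub_eq_add_neg]⟩) hx
  refine ⟨S, hS, p, fun k => (hp k).2, ?_⟩
  rintro y ⟨k, hk⟩
  simpa using (hp k).1 _ hk

/-! ### Every stack of layers is perfect -/

namespace LayerSystem

variable {S : LayerSystem}

theorem frame : ∀ S ∈ systems, 0 < S.h ∧ 0 < S.m ∧ dot S.s S.r₀ = 1 ∧ dot S.c S.r₀ = 0 ∧
    dot S.s S.r₁ = 0 ∧ dot S.c S.r₁ = 1 := by
  decide +kernel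

/-- The first bound means that a conflict can occur only within a layer or between adjacent layers;
the other two clauses exclude these cases. -/
theorem separation : ∀ S ∈ systems, ∀ q ∈ ballSites, |dot S.s q| < 2 * S.h ∧ (S.Lat q → q = 0) ∧
    ∀ u ∈ S.steps, ¬S.Lat (q - u) := by
  decide +kernel

/-- The union of the layers through `0`, `u` and `-d`. -/
def ThreeLayers (S : LayerSystem) (u d y : Site) : Prop :=
  S.Lat y ∨ S.Lat (y - u) ∨ S.Lat (y + d)

instance (u d : Site) : DecidablePred (S.ThreeLayers u d) := fun _ =>
  inferInstanceAs (Decidable (_ ∨ _))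

/-- The sites j·r₀ + i·r₁ represent all positions between two consecutive layers modulo the lattice,
and three layers suffice to supply a pattern. -/
theorem covering_clusters : ∀ S ∈ systems, ∀ j ∈ List.range S.h.toNat,
    ∀ i ∈ List.range S.m.toNat, ∀ u ∈ S.steps, ∀ d ∈ S.steps, ∃ Q ∈ clusters,
      S.ThreeLayers u d ((j : ℤ) • S.r₀ + (i : ℤ) • S.r₁ + Q.1) ∧
        ∃ P ∈ Q.2, ∀ q ∈ P, S.ThreeLayers u d ((j : ℤ) • S.r₀ + (i : ℤ) • S.r₁ + q) := by
  decide +kernel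

theorem covering (hS : S ∈ systems) {i j : ℤ} (hj : 0 ≤ j) (hj' : j < S.h) (hi : 0 ≤ i)
    (hi' : i < S.m) {u d : Site} (hu : u ∈ S.steps) (hd : d ∈ S.steps) :
    ∃ P ∈ patterns, ∀ q ∈ P, S.ThreeLayers u d (j • S.r₀ + i • S.r₁ + q) := by
  obtain ⟨Q, hQ, h, P, hP, h'⟩ := covering_clusters S hS j.toNat (List.mem_range.2 (by omega))
    i.toNat (List.mem_range.2 (by omega)) u hu d hd
  rw [Int.toNat_of_nonneg hj, Int.toNat_of_nonneg hi] at h h'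
  exact ⟨Q.1 :: P, List.mem_flatMap.2 ⟨Q, hQ, List.mem_map.2 ⟨P, hP, rfl⟩⟩,
    List.forall_mem_cons.2 ⟨h, h'⟩⟩

theorem IsPath.dot_eq (hS : S ∈ systems) {p : ℤ → Site} (hp : S.IsPath p) (k : ℤ) :
    dot S.s (p k) = dot S.s (p 0) + S.h * k := by
  have h : ∀ k, dot S.s (p (k + 1)) = dot S.s (p k) + S.h := fun k => by
    have := (inCube_steps S hS _ (hp k)).1
    rw [dot_sub] at this
    linarith
  induction k using Int.induction_on with
  | zero => simp
  | succ k ih => rw [h, ih]; ring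
  | pred k ih =>
    have := h (-(k : ℤ) - 1)
    rw [sub_add_cancel, ih] at this
    linarith

theorem IsPath.dot_of_lat (hS : S ∈ systems) {p : ℤ → Site} (hp : S.IsPath p) {k : ℤ} {y : Site}
    (hy : S.Lat (y - p k)) : dot S.s y = dot S.s (p 0) + S.h * k := by
  have := hy.1
  rw [dot_sub, hp.dot_eq hS] at this
  linarith

theorem neg_mem_ballSites {q : Site} (hq : q ∈ ballSites) : -q ∈ ballSites := by
  rw [mem_ballSites] at hq ⊢
  simpa [dot] using hq

theorem IsPath.admissible (hS : S ∈ systems) {p : ℤ → Site} (hp : S.IsPath p) :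
    Admissible 6 (S.layers p) := by
  have step : ∀ k, ∀ y z, S.Lat (y - p (k + 1)) → S.Lat (z - p k) → y - z ∉ ballSites := by
    intro k y z hy hz hq
    refine (separation S hS _ hq).2.2 _ (hp k) ?_
    have := hy.sub hz
    rwa [show y - p (k + 1) - (z - p k) = y - z - (p (k + 1) - p k) by abel] at this
  rintro y ⟨k, hk⟩ z ⟨l, hl⟩ hne
  show 6 ≤ sqDist y z
  by_contra! hlt
  rw [sqDist_eq_dot, ← mem_ballSites] at hlt
  obtain ⟨h1, h2, -⟩ := separation S hS _ hlt
  rw [dot_sub, hp.dot_of_lat hS hk, hp.dot_of_lat hS hl] at h1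
  have hh := (frame S hS).1
  obtain ⟨h3, h4⟩ := abs_lt.1 h1
  have h5 : k - l < 2 := by
    by_contra! h
    nlinarith
  have h6 : -2 < k - l := by
    by_contra! h
    nlinarith
  obtain h | h | h : k = l ∨ k = l + 1 ∨ l = k + 1 := by omega
  · subst h
    have := hk.sub hl
    rw [sub_sub_sub_cancel_right] at this
    exact hne (sub_eq_zero.1 (h2 this))
  · subst h
    exact step l y z hk hl hlt
  · subst h
    refine step k z y hl hk ?_
    simpa using neg_mem_ballSites hlt

theorem IsPath.patterned (hS : S ∈ systems) {p : ℤ → Site} (hp : S.IsPath p) :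
    Patterned (S.layers p) := by
  intro y
  obtain ⟨hh, hm, h1, h2, h3, h4⟩ := frame S hS
  set t := dot S.s y - dot S.s (p 0) with ht
  set k := t / S.h
  set z := y - p k with hz
  set j := t % S.h with hj
  set i := dot S.c z % S.m with hi
  have hj0 := Int.emod_nonneg t hh.ne'
  have hi0 := Int.emod_nonneg (dot S.c z) hm.ne'
  have hjlt := Int.emod_lt_of_pos t hh
  have hilt := Int.emod_lt_of_pos (dot S.c z) hm
  obtain ⟨P, hP, hPL⟩ := covering hS hj0 hjlt hi0 hilt (hp k) (hp (k - 1))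
  -- `k` is the last layer not above `y`, so `z` has height exactly `j` over it, and `c` takes on
  -- `z` a value congruent to `i` modulo `m`.
  have hr : S.Lat (z - (j • S.r₀ + i • S.r₁)) := by
    constructor <;> rw [dot_sub, dot_add, dot_zsmul, dot_zsmul]
    · rw [h1, h3, hz, dot_sub, hp.dot_eq hS, hj]
      have := Int.mul_ediv_add_emod t S.h
      linarith
    · rw [h2, h4, mul_zero, zero_add, mul_one, hi]
      exact Int.dvd_self_sub_emod
  refine ⟨P, hP, fun q hq => ?_⟩
  rcases hPL q hq with h | h | h
  · refine ⟨k, ?_⟩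
    have := hr.add h
    rwa [show z - (j • S.r₀ + i • S.r₁) + (j • S.r₀ + i • S.r₁ + q) = y + q - p k by
      rw [hz]; abel] at this
  · refine ⟨k + 1, ?_⟩
    have := hr.add h
    rwa [show z - (j • S.r₀ + i • S.r₁) + (j • S.r₀ + i • S.r₁ + q - (p (k + 1) - p k)) =
      y + q - p (k + 1) by rw [hz]; abel] at this
  · refine ⟨k - 1, ?_⟩
    have := hr.add h
    rwa [show z - (j • S.r₀ + i • S.r₁) + (j • S.r₀ + i • S.r₁ + q + (p (k - 1 + 1) - p (k - 1))) =
      y + q - p (k - 1) by rw [hz, sub_add_cancel]; abel] at this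

theorem IsPath.isPerfect (hS : S ∈ systems) {p : ℤ → Site} (hp : S.IsPath p) :
    IsPerfect (S.layers p) :=
  (isPerfect_iff _).2 ⟨hp.admissible hS, hp.patterned hS⟩

end LayerSystem

/-- The inclusion of a stack in a perfect configuration is an equality because the stack, being
perfect, is already maximal. -/
theorem isPerfect_iff_layers (φ : Set Site) :
    IsPerfect φ ↔ ∃ S ∈ systems, ∃ p, S.IsPath p ∧ φ = S.layers p := by
  constructor
  · intro hφ
    obtain ⟨S, hS, p, hp, h⟩ := hφ.exists_layers_subset
    exact ⟨S, hS, p, hp, ((hp.isPerfect hS).eq_of_subset hφ.1 h).symm⟩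
  · rintro ⟨S, hS, p, hp, rfl⟩
    exact hp.isPerfect hS

/-! ### Paths of sites and stackings of projected meshes -/

theorem mem_shift {G : Type*} [AddCommGroup G] {χ : Set G} {v x : G} : x ∈ shift χ v ↔ x - v ∈ χ := by
  constructor
  · rintro ⟨y, hy, rfl⟩
    simpa using hy
  · exact fun h => ⟨x - v, h, sub_add_cancel x v⟩

theorem shift_shift {G : Type*} [AddCommGroup G] (χ : Set G) (v w : G) :
    shift (shift χ v) w = shift χ (v + w) := by
  ext x
  rw [mem_shift, mem_shift, mem_shift, sub_sub, add_comm]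

theorem shift_zero {G : Type*} [AddCommGroup G] (χ : Set G) : shift χ 0 = χ := by
  ext x
  rw [mem_shift, sub_zero]

theorem shift_left_injective {G : Type*} [AddCommGroup G] (v : G) :
    Function.Injective (shift · v : Set G → Set G) := fun χ χ' h => by
  have := congrArg (shift · (-v)) h
  simpa only [shift_shift, add_neg_cancel, shift_zero] using this

/-- A site as a point with rational coordinates. -/
def toPt (x : Site) : Pt := fun l => (x l : ℚ)

theorem toPt_sub (x y : Site) : toPt (x - y) = toPt x - toPt y := by
  funext l
  simp [toPt]

theorem toPt_add (x y : Site) : toPt (x + y) = toPt x + toPt y := by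
  funext l
  simp [toPt]

theorem toPt_zsmul (n : ℤ) (x : Site) : toPt (n • x) = (n : ℚ) • toPt x := by
  funext l
  simp [toPt]

theorem toPt_injective : Function.Injective toPt := fun x y h => by
  funext l
  have : (x l : ℚ) = y l := congrFun h l
  exact_mod_cast this

/-- For negative `k` the terms u(-1), …, u(k) are subtracted. -/
theorem exists_int_sum (u : ℤ → Site) :
    ∃ p : ℤ → Site, p 0 = 0 ∧ ∀ k, p (k + 1) = p k + u k := by
  refine ⟨fun k => if 0 ≤ k then ∑ i ∈ Finset.range k.toNat, u i
    else -∑ i ∈ Finset.range (-k).toNat, u (-i - 1), by simp, fun k => ?_⟩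
  by_cases hk : 0 ≤ k
  · have e : (k + 1).toNat = k.toNat + 1 := by omega
    simp only [if_pos hk, if_pos (show 0 ≤ k + 1 by omega), e, Finset.sum_range_succ,
      Int.toNat_of_nonneg hk]
  · have e : (-k).toNat = (-(k + 1)).toNat + 1 := by omega
    have h1 : -(((-(k + 1)).toNat : ℕ) : ℤ) - 1 = k := by omega
    beta_reduce
    have h2 : ∀ a b : Site, -(a + b) + b = -a := fun a b => by abel
    rw [if_neg hk, e, Finset.sum_range_succ, h1, h2]
    by_cases h0 : 0 ≤ k + 1
    · have : k = -1 := by omega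
      simp [this]
    · rw [if_neg h0]

namespace LayerSystem

/-- The lattice of a layer system as a set of points. -/
def mesh (S : LayerSystem) : Set Pt := planeLattice (toPt S.g₁) (toPt S.g₂)

/-- The component along `s` of the sites with `dot s = h * k`. -/
def height (S : LayerSystem) (k : ℤ) : Pt := ((S.h * k : ℚ) / dot S.s S.s) • toPt S.s

/-- The projections of the layers through the points `p k`. -/
def stacking (S : LayerSystem) (p : ℤ → Site) (k : ℤ) : Set Pt :=
  shift S.mesh (toPt (p k) - S.height k)

/-- Allowed stackings of the meshes of a layer system. -/
def IsStacking (S : LayerSystem) (γ : ℤ → Set Pt) : Prop :=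
  γ 0 = S.mesh ∧ ∀ k, ∃ u ∈ S.steps, γ (k + 1) = shift (γ k) (toPt u - S.height 1)

/-- The layered configuration of a stacking. -/
def layered (S : LayerSystem) (γ : ℤ → Set Pt) : Set Site :=
  sitesOf (⋃ k : ℤ, shift (γ k) (S.height k))

variable {S : LayerSystem}

theorem height_add (k l : ℤ) : S.height (k + l) = S.height k + S.height l := by
  rw [height, height, height, ← add_smul]
  congr 1
  push_cast
  ring

theorem toPt_mem_mesh (hS : S ∈ systems) (z : Site) : toPt z ∈ S.mesh ↔ S.Lat z := by
  constructor
  · rintro ⟨a, b, h⟩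
    rw [← toPt_zsmul, ← toPt_zsmul, ← toPt_add] at h
    rw [toPt_injective h]
    exact ((lat_gens S hS _ (by simp [gens])).1.zsmul a).add
      ((lat_gens S hS _ (by simp [gens])).1.zsmul b)
  · intro h
    obtain ⟨a, b, rfl⟩ := h.exists_coeff hS
    exact ⟨a, b, by rw [toPt_add, toPt_zsmul, toPt_zsmul]⟩

theorem sub_mem_mesh {x y : Pt} (hx : x ∈ S.mesh) (hy : y ∈ S.mesh) : x - y ∈ S.mesh := by
  obtain ⟨a, b, rfl⟩ := hx
  obtain ⟨c, d, rfl⟩ := hy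
  refine ⟨a - c, b - d, ?_⟩
  push_cast
  rw [sub_smul, sub_smul]
  abel

theorem zero_mem_mesh : (0 : Pt) ∈ S.mesh := ⟨0, 0, by simp⟩

theorem shift_mesh_eq_iff {x y : Pt} : shift S.mesh x = shift S.mesh y ↔ x - y ∈ S.mesh := by
  constructor
  · intro h
    rw [← mem_shift, ← h, mem_shift, sub_self]
    exact zero_mem_mesh
  · intro h
    ext z
    rw [mem_shift, mem_shift]
    constructor <;> intro hz
    · have := sub_mem_mesh hz (sub_mem_mesh zero_mem_mesh h)
      rwa [show z - x - (0 - (x - y)) = z - y by abel] at this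
    · have := sub_mem_mesh hz h
      rwa [show z - y - (x - y) = z - x by abel] at this

theorem stacking_zero {p : ℤ → Site} (h0 : p 0 = 0) : S.stacking p 0 = S.mesh := by
  have : toPt 0 - S.height 0 = 0 := by
    funext l
    simp [toPt, height]
  rw [stacking, h0, this, shift_zero]

theorem IsPath.isStacking {p : ℤ → Site} (hp : S.IsPath p) (h0 : p 0 = 0) :
    S.IsStacking (S.stacking p) := by
  refine ⟨?_, fun k => ⟨_, hp k, ?_⟩⟩
  · rw [stacking_zero h0]
  · rw [stacking, stacking, shift_shift, height_add, toPt_sub]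
    congr 1
    abel

/-- Choosing a step for each index and summing gives the path. Shifts are invertible, so the
recursion determines the meshes of negative index as well. -/
theorem IsStacking.exists_path {γ : ℤ → Set Pt} (hγ : S.IsStacking γ) :
    ∃ p, p 0 = 0 ∧ S.IsPath p ∧ γ = S.stacking p := by
  obtain ⟨h0, h⟩ := hγ
  choose u hu hγu using h
  obtain ⟨p, hp0, hp⟩ := exists_int_sum u
  have hp' : ∀ k, p (k + 1) - p k = u k := fun k => by rw [hp, add_sub_cancel_left]
  refine ⟨p, hp0, fun k => by rw [hp']; exact hu k, funext fun k => ?_⟩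
  have step : ∀ k, S.stacking p (k + 1) = shift (S.stacking p k) (toPt (u k) - S.height 1) := by
    intro k
    rw [stacking, stacking, shift_shift, height_add, ← hp' k, toPt_sub]
    congr 1
    abel
  induction k using Int.induction_on with
  | zero => rw [h0, stacking_zero hp0]
  | succ k ih => rw [hγu, step, ih]
  | pred k ih =>
    refine shift_left_injective (toPt (u (-(k : ℤ) - 1)) - S.height 1) ?_
    simp only [← hγu, ← step, sub_add_cancel, ih]

theorem layered_stacking (hS : S ∈ systems) (p : ℤ → Site) :
    S.layered (S.stacking p) = S.layers p := by
  ext y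
  rw [layered, sitesOf]
  show toPt y ∈ (⋃ k : ℤ, _) ↔ ∃ k, _
  rw [Set.mem_iUnion]
  refine exists_congr fun k => ?_
  rw [stacking, shift_shift, sub_add_cancel, mem_shift, ← toPt_sub, toPt_mem_mesh hS]

/-- The layers are periodic up to a translation along `s`. -/
def IsPeriodicPath (S : LayerSystem) (p : ℤ → Site) : Prop :=
  ∃ n : ℤ, 0 < n ∧ ∀ k, S.Lat (p (k + dot S.s S.s * n) - p k - (S.h * n) • S.s)

theorem dot_self_pos : ∀ S ∈ systems, 0 < dot S.s S.s := by decide +kernel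

/-- Climbing |s|² · n layers moves by the integer vector (h n)s along `s`; for other numbers of
layers the displacement along `s` may fail to be integral. -/
theorem stacking_eq_iff (hS : S ∈ systems) (p : ℤ → Site) (k n : ℤ) :
    S.stacking p (k + dot S.s S.s * n) = S.stacking p k ↔
      S.Lat (p (k + dot S.s S.s * n) - p k - (S.h * n) • S.s) := by
  have h : S.height (dot S.s S.s * n) = toPt ((S.h * n) • S.s) := by
    have : (dot S.s S.s : ℚ) ≠ 0 := by exact_mod_cast (dot_self_pos S hS).ne'
    rw [height, toPt_zsmul]
    congr 1
    push_cast
    field_simp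
  rw [stacking, stacking, shift_mesh_eq_iff, ← toPt_mem_mesh hS, toPt_sub, toPt_sub, height_add, h]
  congr! 1
  abel

theorem isPeriodicStacking_iff (hS : S ∈ systems) (p : ℤ → Site) :
    IsPeriodicStacking (S.stacking p) ↔ S.IsPeriodicPath p := by
  have hpos := dot_self_pos S hS
  constructor
  · rintro ⟨n, hn, h⟩
    refine ⟨n, by exact_mod_cast hn, fun k => (stacking_eq_iff hS p k n).1 ?_⟩
    -- A period `n` of the stacking yields the period |s|² · n by repetition.
    obtain ⟨m, hm⟩ := Int.eq_ofNat_of_zero_le hpos.le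
    rw [hm]
    clear hm
    induction m with
    | zero => simp
    | succ m ih => rw [← ih, ← h (k + m * n)]; congr 1; push_cast; ring
  · rintro ⟨n, hn, h⟩
    refine ⟨(dot S.s S.s * n).toNat, by have := mul_pos hpos hn; omega, fun k => ?_⟩
    rw [Int.toNat_of_nonneg (by positivity)]
    exact (stacking_eq_iff hS p k n).2 (h k)

theorem shift_layers (p : ℤ → Site) (v : Site) :
    shift (S.layers p) v = S.layers (fun k => p k + v) := by
  ext y
  rw [mem_shift]
  exact exists_congr fun k => by rw [sub_sub, add_comm v]

theorem IsPath.add_const {p : ℤ → Site} (hp : S.IsPath p) (v : Site) :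
    S.IsPath fun k => p k + v := fun k => by
  simpa using hp k

theorem IsPeriodicPath.add_const {p : ℤ → Site} (hp : S.IsPeriodicPath p) (v : Site) :
    S.IsPeriodicPath fun k => p k + v := by
  obtain ⟨n, hn, h⟩ := hp
  exact ⟨n, hn, fun k => by simpa using h k⟩

end LayerSystem

/-! ### Identification with the given triangular and rhombic families -/

theorem triSystem_coords : ∀ i l, mainDiag i l = toPt (triSystem i).s l ∧
    triVec i 1 l = toPt (triSystem i).g₁ l ∧ triVec i 2 l = toPt (triSystem i).g₂ l := by
  decide +kernel

theorem rhoSystem_coords : ∀ i l, nonMainDiag i l = toPt (rhoSystem i).s l ∧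
    ((2 : ℚ) • vecA i + (2 : ℚ) • vecB i) l = toPt (rhoSystem i).g₁ l ∧
      ((2 : ℚ) • vecA i - (2 : ℚ) • vecB i) l = toPt (rhoSystem i).g₂ l := by
  decide +kernel

theorem triMesh_eq (i : Fin 4) : triMesh i = (triSystem i).mesh := by
  rw [triMesh, LayerSystem.mesh, funext fun l => (triSystem_coords i l).2.1,
    funext fun l => (triSystem_coords i l).2.2]

theorem rhoMesh_eq (i : Fin 6) : rhoMesh i = (rhoSystem i).mesh := by
  rw [rhoMesh, LayerSystem.mesh, funext fun l => (rhoSystem_coords i l).2.1,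
    funext fun l => (rhoSystem_coords i l).2.2]

theorem triSystem_height (i : Fin 4) (k : ℤ) :
    (4 * (k : ℚ) / 3) • mainDiag i = (triSystem i).height k := by
  have h : (dot (triSystem i).s (triSystem i).s) = 3 := by fin_cases i <;> rfl
  rw [LayerSystem.height, h, funext fun l => (triSystem_coords i l).1]
  norm_num [triSystem]

theorem rhoSystem_height (i : Fin 6) (k : ℤ) :
    (3 * (k : ℚ) / 2) • nonMainDiag i = (rhoSystem i).height k := by
  have h : (dot (rhoSystem i).s (rhoSystem i).s) = 2 := by fin_cases i <;> rfl
  have h' : (rhoSystem i).h = 3 := by fin_cases i <;> rfl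
  rw [LayerSystem.height, h, h', funext fun l => (rhoSystem_coords i l).1]
  norm_num

theorem triLayered_eq (i : Fin 4) (γ : ℤ → Set Pt) :
    triLayered i γ = (triSystem i).layered γ := by
  simp only [triLayered, LayerSystem.layered, triSystem_height]

theorem rhoLayered_eq (i : Fin 6) (γ : ℤ → Set Pt) :
    rhoLayered i γ = (rhoSystem i).layered γ := by
  simp only [rhoLayered, LayerSystem.layered, rhoSystem_height]

theorem triSystem_steps : ∀ i, (triSystem i).steps = [![1, (mainSign i).1, 2 * (mainSign i).2],
    ![1, 2 * (mainSign i).1, (mainSign i).2], ![2, (mainSign i).1, (mainSign i).2]] := fun _ => rfl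

theorem triVec_eq : ∀ i l,
    ((1 / 3 : ℚ) • triVec i 2) l = (toPt ![1, (mainSign i).1, 2 * (mainSign i).2] -
      (4 * ((1 : ℤ) : ℚ) / 3) • mainDiag i) l ∧
    ((1 / 3 : ℚ) • triVec i 4) l = (toPt ![1, 2 * (mainSign i).1, (mainSign i).2] -
      (4 * ((1 : ℤ) : ℚ) / 3) • mainDiag i) l ∧
    ((1 / 3 : ℚ) • triVec i 6) l = (toPt ![2, (mainSign i).1, (mainSign i).2] -
      (4 * ((1 : ℤ) : ℚ) / 3) • mainDiag i) l := by
  decide +kernel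

theorem isTriStacking_iff (i : Fin 4) (γ : ℤ → Set Pt) :
    IsTriStacking i γ ↔ (triSystem i).IsStacking γ := by
  have h2 := funext fun l => (triVec_eq i l).1
  have h4 := funext fun l => (triVec_eq i l).2.1
  have h6 := funext fun l => (triVec_eq i l).2.2
  rw [triSystem_height] at h2 h4 h6
  refine and_congr (by rw [triMesh_eq]) (forall_congr' fun k => ?_)
  simp only [or_and_right, exists_or, exists_eq_left, h2, h4, h6, triSystem_steps,
    List.mem_cons, List.not_mem_nil, or_false]

theorem rhoSystem_steps : ∀ i, ∃ u v, (rhoSystem i).steps = [u, v] ∧ ∀ l,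
    (vecA i + vecB i) l = (toPt u - (3 * ((1 : ℤ) : ℚ) / 2) • nonMainDiag i) l ∧
    (vecA i - vecB i) l = (toPt v - (3 * ((1 : ℤ) : ℚ) / 2) • nonMainDiag i) l := by
  intro i
  refine ⟨(rhoSystem i).steps.headD 0, (rhoSystem i).steps.getLastD 0, ?_, ?_⟩
  · fin_cases i <;> rfl
  · revert i
    decide +kernel

theorem isRhoStacking_iff (i : Fin 6) (γ : ℤ → Set Pt) :
    IsRhoStacking i γ ↔ (rhoSystem i).IsStacking γ := by
  obtain ⟨u, v, h, h'⟩ := rhoSystem_steps i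
  have hu := funext fun l => (h' l).1
  have hv := funext fun l => (h' l).2
  rw [rhoSystem_height] at hu hv
  refine and_congr (by rw [rhoMesh_eq]) (forall_congr' fun k => ?_)
  rw [h, hu, hv]
  simp

theorem mem_layeredSet (φ : Set Site) : φ ∈ layeredSet ↔
    ∃ S ∈ systems, ∃ p, S.IsPath p ∧ φ = S.layers p := by
  constructor
  · have key : ∀ S ∈ systems, ∀ γ v, S.IsStacking γ →
        ∃ p, S.IsPath p ∧ shift (S.layered γ) v = S.layers p := by
      intro S hS γ v hγ
      obtain ⟨p, -, hp, rfl⟩ := hγ.exists_path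
      exact ⟨_, hp.add_const v, by rw [LayerSystem.layered_stacking hS, LayerSystem.shift_layers]⟩
    rintro ⟨v, ⟨i, γ, hγ, rfl⟩ | ⟨i, γ, hγ, rfl⟩⟩
    · have hS : triSystem i ∈ systems := mem_systems.2 (.inl ⟨i, rfl⟩)
      rw [triLayered_eq]
      exact ⟨_, hS, key _ hS γ v ((isTriStacking_iff i γ).1 hγ)⟩
    · have hS : rhoSystem i ∈ systems := mem_systems.2 (.inr ⟨i, rfl⟩)
      rw [rhoLayered_eq]
      exact ⟨_, hS, key _ hS γ v ((isRhoStacking_iff i γ).1 hγ)⟩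
  · rintro ⟨S, hS, p, hp, rfl⟩
    have hst := (hp.add_const (-p 0)).isStacking (by simp)
    have e : S.layers p = shift (S.layered (S.stacking fun k => p k + -p 0)) (p 0) := by
      simp [LayerSystem.layered_stacking hS, LayerSystem.shift_layers]
    rw [e]
    rcases mem_systems.1 hS with ⟨i, rfl⟩ | ⟨i, rfl⟩
    · exact ⟨p 0, .inl ⟨i, _, (isTriStacking_iff i _).2 hst, by rw [triLayered_eq]⟩⟩
    · exact ⟨p 0, .inr ⟨i, _, (isRhoStacking_iff i _).2 hst, by rw [rhoLayered_eq]⟩⟩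

theorem mem_periodicLayeredSet (φ : Set Site) : φ ∈ periodicLayeredSet ↔
    ∃ S ∈ systems, ∃ p, S.IsPath p ∧ S.IsPeriodicPath p ∧ φ = S.layers p := by
  constructor
  · have key : ∀ S ∈ systems, ∀ γ v, S.IsStacking γ → IsPeriodicStacking γ →
        ∃ p, S.IsPath p ∧ S.IsPeriodicPath p ∧ shift (S.layered γ) v = S.layers p := by
      intro S hS γ v hγ hper
      obtain ⟨p, -, hp, rfl⟩ := hγ.exists_path
      exact ⟨_, hp.add_const v,
        ((LayerSystem.isPeriodicStacking_iff hS p).1 hper).add_const v,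
        by rw [LayerSystem.layered_stacking hS, LayerSystem.shift_layers]⟩
    rintro ⟨v, ⟨i, γ, hγ, hper, rfl⟩ | ⟨i, γ, hγ, hper, rfl⟩⟩
    · have hS : triSystem i ∈ systems := mem_systems.2 (.inl ⟨i, rfl⟩)
      rw [triLayered_eq]
      exact ⟨_, hS, key _ hS γ v ((isTriStacking_iff i γ).1 hγ) hper⟩
    · have hS : rhoSystem i ∈ systems := mem_systems.2 (.inr ⟨i, rfl⟩)
      rw [rhoLayered_eq]
      exact ⟨_, hS, key _ hS γ v ((isRhoStacking_iff i γ).1 hγ) hper⟩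
  · rintro ⟨S, hS, p, hp, hper, rfl⟩
    have hst := (hp.add_const (-p 0)).isStacking (by simp)
    have hper := (LayerSystem.isPeriodicStacking_iff hS _).2 (hper.add_const (-p 0))
    have e : S.layers p = shift (S.layered (S.stacking fun k => p k + -p 0)) (p 0) := by
      simp [LayerSystem.layered_stacking hS, LayerSystem.shift_layers]
    rw [e]
    rcases mem_systems.1 hS with ⟨i, rfl⟩ | ⟨i, rfl⟩
    · exact ⟨p 0, .inl ⟨i, _, (isTriStacking_iff i _).2 hst, hper, by rw [triLayered_eq]⟩⟩
    · exact ⟨p 0, .inr ⟨i, _, (isRhoStacking_iff i _).2 hst, hper, by rw [rhoLayered_eq]⟩⟩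

/-! ### Periodic configurations and periodic stackings -/

/-- The group of the translations that preserve a configuration. -/
def translations (φ : Set Site) : AddSubgroup Site where
  carrier := {v | ∀ x, x + v ∈ φ ↔ x ∈ φ}
  zero_mem' := fun x => by rw [add_zero]
  add_mem' := fun {v w} hv hw x => by rw [← add_assoc, hw, hv]
  neg_mem' := fun {v} hv x => by rw [← hv (x + -v), neg_add_cancel_right]

/-- By the adjugate formula det(e)·x is an integer combination of the three periods, so N = |det e|
works. -/
theorem IsPeriodic.exists_zsmul_mem {φ : Set Site} (h : IsPeriodic φ) :
    ∃ N : ℕ, 0 < N ∧ ∀ x, (N : ℤ) • x ∈ translations φ := by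
  obtain ⟨e, he, hφ⟩ := h
  have hdet : (Matrix.of e).det ≠ 0 := by
    intro h0
    obtain ⟨v, hv, hv0⟩ := Matrix.exists_vecMul_eq_zero_iff.2 h0
    refine hv (funext (Fintype.linearIndependent_iff.1 he v ?_))
    rw [← hv0]
    funext l
    simp [Matrix.vecMul, dotProduct]
  have hmem : ∀ x : Site, (Matrix.of e).det • x ∈ translations φ := by
    intro x
    have hx : (Matrix.of e).det • x = ∑ i, (Matrix.vecMul x (Matrix.of e).adjugate) i • e i := by
      have h1 : Matrix.vecMul (Matrix.vecMul x (Matrix.of e).adjugate) (Matrix.of e) =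
          (Matrix.of e).det • x := by
        rw [Matrix.vecMul_vecMul, Matrix.adjugate_mul, Matrix.vecMul_smul, Matrix.vecMul_one]
      rw [← h1]
      funext l
      simp [Matrix.vecMul, dotProduct]
    rw [hx]
    exact sum_mem fun i _ => zsmul_mem (show e i ∈ translations φ from hφ i) _
  refine ⟨(Matrix.of e).det.natAbs, Int.natAbs_pos.2 hdet, fun x => ?_⟩
  rcases Int.natAbs_eq (Matrix.of e).det with h | h
  · rw [← h]
    exact hmem x
  · have := hmem (-x)
    rwa [smul_neg, ← neg_smul, neg_eq_iff_eq_neg.2 h] at this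

/-- A configuration invariant under Nℤ³ is the preimage of a subset of the finite group (ℤ/N)³. -/
theorem countable_setOf_isPeriodic : {φ : Set Site | IsPeriodic φ}.Countable := by
  refine Set.Countable.mono (s₂ := ⋃ N : ℕ, Set.range fun A : Set (Fin 3 → ZMod (N + 1)) =>
    {x : Site | (fun l => (x l : ZMod (N + 1))) ∈ A}) ?_
    (Set.countable_iUnion fun N => Set.countable_range _)
  intro φ hφ
  obtain ⟨N, hN, h⟩ := IsPeriodic.exists_zsmul_mem hφ
  obtain ⟨N, rfl⟩ := Nat.exists_eq_add_of_le' hN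
  refine Set.mem_iUnion.2 ⟨N, (fun x l => (x l : ZMod (N + 1))) '' φ, ?_⟩
  ext x
  constructor
  · rintro ⟨y, hy, hxy⟩
    have hd : ∀ l, ∃ t : ℤ, x l = y l + ((N + 1 : ℕ) : ℤ) * t := fun l => by
      have h1 : ((y l : ℤ) : ZMod (N + 1)) = (x l : ℤ) := congrFun hxy l
      obtain ⟨t, ht⟩ := (ZMod.intCast_eq_intCast_iff_dvd_sub _ _ _).1 h1
      exact ⟨t, by rw [← ht]; ring⟩
    choose t ht using hd
    have hx : x = y + ((N + 1 : ℕ) : ℤ) • t := funext fun l => by simp [ht l]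
    rw [hx]
    exact (h t y).2 hy
  · exact fun hx => ⟨x, hx, rfl⟩

namespace LayerSystem

variable {S : LayerSystem}

theorem lat_add_iff {y z : Site} (hz : S.Lat z) : S.Lat (y + z) ↔ S.Lat y :=
  ⟨fun h => by simpa using h.sub hz, fun h => h.add hz⟩

theorem lat_of_self_mem {p : ℤ → Site} (k : ℤ) : p k ∈ S.layers p :=
  ⟨k, by rw [sub_self]; exact lat_zero⟩

theorem basis_dot : ∀ S ∈ systems, dot S.c S.g₁ = S.m ∧ dot S.c S.g₂ = 0 ∧
    dot S.e S.g₂ = -1 := by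
  decide +kernel

/-- A period N·s sends each layer to a layer a fixed number `m` of indices higher, with h·m =
N·|s|². Conversely a periodic path gives the periods g₁, g₂ and (h n)s. -/
theorem IsPath.isPeriodic_iff (hS : S ∈ systems) {p : ℤ → Site} (hp : S.IsPath p) :
    IsPeriodic (S.layers p) ↔ S.IsPeriodicPath p := by
  have hss := dot_self_pos S hS
  obtain ⟨hh, hm, -⟩ := frame S hS
  constructor
  · intro h
    obtain ⟨N, hN, h⟩ := h.exists_zsmul_mem
    set E := (N : ℤ) • S.s with hE
    have hEp : ∀ k, ∃ l, S.Lat (p k + E - p l) := fun k => (h S.s (p k)).2 (lat_of_self_mem k)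
    have hdot : ∀ k l, S.Lat (p k + E - p l) → S.h * (l - k) = N * dot S.s S.s := fun k l hl => by
      have := hp.dot_of_lat hS hl
      rw [dot_add, hE, dot_zsmul, hp.dot_eq hS k] at this
      linarith
    obtain ⟨m, hm0⟩ := hEp 0
    have hm := hdot 0 m hm0
    rw [sub_zero] at hm
    have hstep : ∀ k, S.Lat (p (k + m) - p k - E) := fun k => by
      obtain ⟨l, hl⟩ := hEp k
      have h1 : l - k = m := mul_left_cancel₀ hh.ne' ((hdot k l hl).trans hm.symm)
      rw [show k + m = l by omega]
      have := hl.neg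
      rwa [show -(p k + E - p l) = p l - p k - E by abel] at this
    refine ⟨m, pos_of_mul_pos_right (hm ▸ by positivity) hh.le, fun k => ?_⟩
    -- Taking j = |s|² gives the total shift |s|²·N·s = (h m)s, as required.
    have key : ∀ j : ℕ, S.Lat (p (k + j * m) - p k - (j : ℤ) • E) := by
      intro j
      induction j with
      | zero => simp [lat_zero]
      | succ j ih =>
        have := (hstep (k + j * m)).add ih
        rw [show k + ((j + 1 : ℕ) : ℤ) * m = k + j * m + m by push_cast; ring]
        rwa [show p (k + j * m + m) - p (k + j * m) - E + (p (k + j * m) - p k - (j : ℤ) • E) =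
          p (k + j * m + m) - p k - ((j + 1 : ℕ) : ℤ) • E by
            push_cast; rw [add_smul, one_smul]; abel] at this
    have := key (dot S.s S.s).toNat
    rwa [Int.toNat_of_nonneg hss.le, hE, smul_smul, mul_comm _ (N : ℤ), ← hm] at this
  · rintro ⟨n, hn, h⟩
    have hg₁ := (lat_gens S hS S.g₁ (by simp [gens])).1
    have hg₂ := (lat_gens S hS S.g₂ (by simp [gens])).1
    refine ⟨![S.g₁, S.g₂, (S.h * n) • S.s], ?_, ?_⟩
    · rw [Fintype.linearIndependent_iff]
      intro a ha
      rw [Fin.sum_univ_three] at ha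
      replace ha : a 0 • S.g₁ + a 1 • S.g₂ + a 2 • (S.h * n) • S.s = 0 := ha
      obtain ⟨h1, h2, h3⟩ := basis_dot S hS
      have hs := congrArg (dot S.s) ha
      have hc := congrArg (dot S.c) ha
      have he := congrArg (dot S.e) ha
      have h0 : ∀ u, dot u 0 = 0 := fun u => by simp [dot]
      -- Apply `s`, then `c`, then `e`: they isolate the coefficients a₂, a₀ and a₁ in turn.
      simp only [dot_add, dot_zsmul, hg₁.1, hg₂.1, h0, mul_zero, zero_add] at hs
      have ha2 : a 2 = 0 := by
        have : S.h * n * dot S.s S.s ≠ 0 := by positivity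
        exact (mul_eq_zero.1 hs).resolve_right this
      simp only [dot_add, dot_zsmul, h1, h2, h0, ha2, mul_zero, zero_mul, add_zero] at hc
      have ha0 : a 0 = 0 := (mul_eq_zero.1 hc).resolve_right hm.ne'
      simp only [dot_add, dot_zsmul, h3, h0, ha2, ha0, zero_mul, add_zero, zero_add] at he
      have ha1 : a 1 = 0 := by omega
      intro i
      fin_cases i <;> assumption
    · have hlat : ∀ g, S.Lat g → ∀ x, x + g ∈ S.layers p ↔ x ∈ S.layers p := fun g hg x =>
        exists_congr fun k => by rw [add_sub_right_comm, lat_add_iff hg]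
      intro i
      fin_cases i
      · exact hlat _ hg₁
      · exact hlat _ hg₂
      · intro x
        show x + (S.h * n) • S.s ∈ S.layers p ↔ x ∈ S.layers p
        constructor
        · rintro ⟨k, hk⟩
          refine ⟨k - dot S.s S.s * n, ?_⟩
          have := hk.add (h (k - dot S.s S.s * n))
          rw [sub_add_cancel] at this
          rwa [show x + (S.h * n) • S.s - p k + (p k - p (k - dot S.s S.s * n) - (S.h * n) • S.s) =
            x - p (k - dot S.s S.s * n) by abel] at this
        · rintro ⟨k, hk⟩
          refine ⟨k + dot S.s S.s * n, ?_⟩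
          have := hk.sub (h k)
          rwa [show x - p k - (p (k + dot S.s S.s * n) - p k - (S.h * n) • S.s) =
            x + (S.h * n) • S.s - p (k + dot S.s S.s * n) by abel] at this

end LayerSystem

theorem isPerfect_and_isPeriodic_iff (φ : Set Site) :
    IsPerfect φ ∧ IsPeriodic φ ↔ φ ∈ periodicLayeredSet := by
  rw [isPerfect_iff_layers, mem_periodicLayeredSet]
  constructor
  · rintro ⟨⟨S, hS, p, hp, rfl⟩, h⟩
    exact ⟨S, hS, p, hp, (hp.isPeriodic_iff hS).1 h, rfl⟩
  · rintro ⟨S, hS, p, hp, h, rfl⟩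
    exact ⟨⟨S, hS, p, hp, rfl⟩, (hp.isPeriodic_iff hS).2 h⟩

/-! ### The number of layered configurations -/

theorem exists_binary_path (f : ℤ → Bool) : ∃ p : ℤ → Site, p 0 = 0 ∧ (triSystem 0).IsPath p ∧
    ∀ k, p (k + 1) = p k + if f k then ![1, 1, 2] else ![1, 2, 1] := by
  obtain ⟨p, h0, hp⟩ := exists_int_sum fun k => if f k then ![1, 1, 2] else ![1, 2, 1]
  refine ⟨p, h0, fun k => ?_, hp⟩
  rw [hp, add_sub_cancel_left]
  cases f k
  · exact (by decide : (![1, 2, 1] : Site) ∈ (triSystem 0).steps)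
  · exact (by decide : (![1, 1, 2] : Site) ∈ (triSystem 0).steps)

/-- The path with steps prescribed by a binary sequence. -/
noncomputable def binaryPath (f : ℤ → Bool) : ℤ → Site := (exists_binary_path f).choose

theorem binaryPath_zero (f : ℤ → Bool) : binaryPath f 0 = 0 := (exists_binary_path f).choose_spec.1

theorem isPath_binaryPath (f : ℤ → Bool) : (triSystem 0).IsPath (binaryPath f) :=
  (exists_binary_path f).choose_spec.2.1

theorem binaryPath_add_one (f : ℤ → Bool) (k : ℤ) :
    binaryPath f (k + 1) = binaryPath f k + if f k then ![1, 1, 2] else ![1, 2, 1] :=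
  (exists_binary_path f).choose_spec.2.2 k

theorem triSystem_mem_systems (i : Fin 4) : triSystem i ∈ systems := mem_systems.2 (.inl ⟨i, rfl⟩)

/-- Heights match the layers index by index, so corresponding steps agree modulo the lattice; the
two steps used lie in different classes. -/
theorem layers_binaryPath_injective :
    Function.Injective fun f => (triSystem 0).layers (binaryPath f) := by
  intro f g h
  have hS := triSystem_mem_systems 0
  have key : ∀ k, (triSystem 0).Lat (binaryPath f k - binaryPath g k) := by
    intro k
    have hk : binaryPath f k ∈ (triSystem 0).layers (binaryPath f) := LayerSystem.lat_of_self_mem k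
    rw [show (triSystem 0).layers (binaryPath f) = (triSystem 0).layers (binaryPath g) from h] at hk
    obtain ⟨l, hl⟩ := hk
    have h1 := (isPath_binaryPath g).dot_of_lat hS hl
    rw [(isPath_binaryPath f).dot_eq hS, binaryPath_zero, binaryPath_zero] at h1
    have h2 : k = l := mul_left_cancel₀ (LayerSystem.frame _ hS).1.ne' (by linarith)
    rwa [← h2] at hl
  funext k
  have h1 := (key (k + 1)).sub (key k)
  rw [binaryPath_add_one, binaryPath_add_one, add_sub_add_comm, add_sub_cancel_left] at h1
  cases hf : f k <;> cases hg : g k <;> rw [hf, hg] at h1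
  · exact absurd h1 (by decide)
  · exact absurd h1 (by decide)

theorem mk_layeredSet : Cardinal.mk layeredSet = Cardinal.continuum := by
  apply le_antisymm
  · refine (Cardinal.mk_set_le _).trans ?_
    rw [Cardinal.mk_set, Cardinal.mk_eq_aleph0, Cardinal.two_power_aleph0]
  · have h : Cardinal.mk (ℤ → Bool) = Cardinal.continuum := by
      simp
    rw [← h]
    exact Cardinal.mk_le_of_injective
      (f := fun f => (⟨(triSystem 0).layers (binaryPath f), (mem_layeredSet _).2
        ⟨_, triSystem_mem_systems 0, _, isPath_binaryPath f, rfl⟩⟩ : layeredSet))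
      fun f g h => layers_binaryPath_injective (congrArg Subtype.val h)

/-- Each step has projection a third of a lattice vector, so three times a step is 4s modulo the
lattice. -/
theorem binaryPath_multiple (f : ℤ → Bool) (k : ℤ) :
    (triSystem 0).Lat ((3 : ℤ) • binaryPath f k - (4 * k) • (triSystem 0).s) := by
  have h : ∀ k, (triSystem 0).Lat
      ((3 : ℤ) • (binaryPath f (k + 1) - binaryPath f k) - (4 : ℤ) • (triSystem 0).s) := fun k =>
    (by decide : ∀ u ∈ (triSystem 0).steps,
      (triSystem 0).Lat ((3 : ℤ) • u - (4 : ℤ) • (triSystem 0).s)) _ (isPath_binaryPath f k)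
  have e : ∀ k, (3 : ℤ) • binaryPath f (k + 1) - (4 * (k + 1)) • (triSystem 0).s =
      (3 : ℤ) • binaryPath f k - (4 * k) • (triSystem 0).s +
        ((3 : ℤ) • (binaryPath f (k + 1) - binaryPath f k) - (4 : ℤ) • (triSystem 0).s) := fun k => by
    rw [mul_add, mul_one, add_smul, smul_sub]
    abel
  induction k using Int.induction_on with
  | zero => simp [binaryPath_zero, LayerSystem.lat_zero]
  | succ k ih =>
    rw [e]
    exact ih.add (h _)
  | pred k ih =>
    rw [← LayerSystem.lat_add_iff (h _), ← e, sub_add_cancel]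
    exact ih

/-- Even if the steps over one period do not sum to a lattice vector after projection, three periods
do, and |s|² = 3. -/
theorem isPeriodicPath_binaryPath {f : ℤ → Bool} {n : ℤ} (hn : 0 < n) (h : ∀ k, f (k + n) = f k) :
    (triSystem 0).IsPeriodicPath (binaryPath f) := by
  have key : ∀ k, binaryPath f (k + n) = binaryPath f k + binaryPath f n := by
    have e : ∀ k, binaryPath f (k + 1 + n) - binaryPath f (k + 1) =
        binaryPath f (k + n) - binaryPath f k := fun k => by
      rw [add_right_comm, binaryPath_add_one, binaryPath_add_one, h]
      abel
    have e' : ∀ k, binaryPath f (k + n) - binaryPath f k = binaryPath f n := by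
      intro k
      induction k using Int.induction_on with
      | zero => simp [binaryPath_zero]
      | succ k ih => rw [e, ih]
      | pred k ih => rw [← e, sub_add_cancel, ih]
    exact fun k => by rw [← e' k, add_sub_cancel]
  refine ⟨n, hn, fun k => ?_⟩
  have h3 : k + dot (triSystem 0).s (triSystem 0).s * n = k + n + n + n := by
    rw [show dot (triSystem 0).s (triSystem 0).s = 3 from rfl]
    ring
  rw [h3, key, key, key]
  convert binaryPath_multiple f n using 1
  rw [show (triSystem 0).h = 4 from rfl]
  rw [show (3 : ℤ) = 1 + 1 + 1 from rfl, add_smul, add_smul, one_smul]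
  abel

theorem mk_periodicLayeredSet : Cardinal.mk periodicLayeredSet = Cardinal.aleph0 := by
  have hc : Countable periodicLayeredSet :=
    (countable_setOf_isPeriodic.mono fun φ hφ =>
      ((isPerfect_and_isPeriodic_iff φ).2 hφ).2).to_subtype
  -- The indicator sequences of the multiples of n + 1 are periodic and pairwise distinct.
  let F : ℕ → periodicLayeredSet := fun n =>
    ⟨(triSystem 0).layers (binaryPath fun k => decide (((n : ℤ) + 1) ∣ k)),
      (mem_periodicLayeredSet _).2 ⟨_, triSystem_mem_systems 0, _, isPath_binaryPath _,
        isPeriodicPath_binaryPath (n := n + 1) (by positivity) (by simp), rfl⟩⟩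
  have hF : Function.Injective F := by
    intro m n h
    have h1 := layers_binaryPath_injective (congrArg Subtype.val h)
    have h2 : ∀ k : ℤ, ((m : ℤ) + 1 ∣ k) ↔ ((n : ℤ) + 1 ∣ k) := fun k => by
      simpa using congrFun h1 k
    have h3 := Int.le_of_dvd (by positivity) ((h2 _).1 dvd_rfl)
    have h4 := Int.le_of_dvd (by positivity) ((h2 _).2 dvd_rfl)
    omega
  have hi : Infinite periodicLayeredSet := Infinite.of_injective F hF
  exact Cardinal.mk_eq_aleph0 _

/-! ### Particle density by double counting -/

/-- The sites of the cube `[-n, n]³`. -/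
noncomputable def cube (n : ℕ) : Finset Site := Finset.Icc (fun _ => -(n : ℤ)) fun _ => (n : ℤ)

theorem card_cube (n : ℕ) : (cube n).card = (2 * n + 1) ^ 3 := by
  rw [cube, Pi.card_Icc]
  simp only [Int.card_Icc, Finset.prod_const, Finset.card_univ, Fintype.card_fin]
  congr 1
  omega

theorem mem_cube_of_mem_ball {n : ℕ} {x y : Site} (hx : x ∈ cube n) (h : sqDist x y < 6) :
    y ∈ cube (n + 2) := by
  rw [sqDist_eq_dot, ← mem_ballSites] at h
  have h := inCube_of_mem_ballSites _ h
  rw [cube, Finset.mem_Icc] at hx ⊢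
  constructor <;> intro l <;> have h1 := abs_le.1 (h l) <;>
    have h2 : -(n : ℤ) ≤ x l := hx.1 l <;> have h3 : x l ≤ n := hx.2 l <;>
    simp only [Pi.sub_apply] at h1 <;> push_cast <;> omega

theorem sqDist_comm (x y : Site) : sqDist x y = sqDist y x := by
  rw [sqDist_eq_dot, sqDist_eq_dot]
  simp only [dot, Pi.sub_apply]
  ring

theorem mem_ball_comm {x y : Site} : y ∈ ball x ↔ x ∈ ball y := by
  rw [mem_ball, mem_ball, sqDist_comm]

theorem force_nonneg (t : ℤ) : 0 ≤ force t := by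
  rw [force_eq_weight]
  positivity

theorem sum_force_ball (y : Site) : ∑ x ∈ ball y, force (sqDist x y) = 12 := by
  have h : (ballSites.map fun p => weight (dot p p)).sum = 288 := by decide +kernel
  rw [ball_eq_image, Finset.sum_image (by simp)]
  have e : ∀ p : Site, sqDist (y + p) y = dot p p := fun p => by
    rw [sqDist_eq_dot]
    simp [dot]
  simp only [e, force_eq_weight]
  rw [← Finset.sum_div, ← Nat.cast_sum, List.sum_toFinset _ nodup_ballSites, h]
  norm_num

open Classical in
/-- The occupied sites of a cube. -/
noncomputable def occupied (φ : Set Site) (n : ℕ) : Finset Site := {x ∈ cube n | x ∈ φ}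

/-- Exchanging the sums: a site of the cube feels only particles within two units of it in each
coordinate, hence the enlarged cube. -/
theorem sum_potential (φ : Set Site) (n : ℕ) : ∑ x ∈ cube n, potential φ x =
    1 / 12 * ∑ y ∈ occupied φ (n + 2), ∑ x ∈ cube n with x ∈ ball y, force (sqDist x y) := by
  classical
  simp only [potential]
  rw [← Finset.mul_sum]
  congr 1
  have h : ∀ x ∈ cube n, (∑ y ∈ ball x, if y ∈ φ then force (sqDist x y) else 0) =
      ∑ y ∈ occupied φ (n + 2), if x ∈ ball y then force (sqDist x y) else 0 := by
    intro x hx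
    rw [occupied, Finset.sum_filter, ← Finset.sum_filter, ← Finset.sum_filter,
      ← Finset.sum_filter, Finset.filter_filter]
    refine Finset.sum_congr ?_ fun _ _ => rfl
    ext y
    simp only [Finset.mem_filter]
    constructor
    · rintro ⟨hy, hyφ⟩
      exact ⟨mem_cube_of_mem_ball hx ((mem_ball _ _).1 hy), hyφ, mem_ball_comm.1 hy⟩
    · rintro ⟨-, hyφ, hy⟩
      exact ⟨mem_ball_comm.1 hy, hyφ⟩
  rw [Finset.sum_congr rfl h, Finset.sum_comm]
  refine Finset.sum_congr rfl fun y _ => ?_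
  rw [Finset.sum_filter]

theorem IsPerfect.sum_potential {φ : Set Site} (hφ : IsPerfect φ) (n : ℕ) :
    ∑ x ∈ cube n, potential φ x = 1 / 12 * (2 * n + 1) ^ 3 := by
  rw [Finset.sum_congr rfl fun x _ => ((isPerfect_iff_potential φ).1 hφ).2 x, Finset.sum_const,
    card_cube]
  rw [nsmul_eq_mul]
  push_cast
  ring

/-- A particle near the boundary distributes at most its full force 12 to the sites of the cube. -/
theorem IsPerfect.le_occupied {φ : Set Site} (hφ : IsPerfect φ) (n : ℕ) :
    (2 * n + 1) ^ 3 ≤ 12 * (occupied φ (n + 2)).card := by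
  have h1 := hφ.sum_potential n
  rw [_root_.sum_potential] at h1
  have h2 : ∑ y ∈ occupied φ (n + 2), ∑ x ∈ cube n with x ∈ ball y, force (sqDist x y) ≤
      ∑ y ∈ occupied φ (n + 2), (12 : ℚ) := by
    refine Finset.sum_le_sum fun y _ => ?_
    rw [← sum_force_ball y]
    exact Finset.sum_le_sum_of_subset_of_nonneg (fun x hx => (Finset.mem_filter.1 hx).2)
      fun _ _ _ => force_nonneg _
  rw [Finset.sum_const, nsmul_eq_mul] at h2
  have : ((2 * n + 1 : ℕ) : ℚ) ^ 3 ≤ 12 * ((occupied φ (n + 2)).card : ℚ) := by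
    push_cast
    linarith
  exact_mod_cast this

/-- The ball around a particle of the smaller cube lies in the cube enlarged by 2, so it contributes
its full force 12 there. -/
theorem IsPerfect.occupied_le {φ : Set Site} (hφ : IsPerfect φ) (n : ℕ) :
    12 * (occupied φ n).card ≤ (2 * (n + 2) + 1) ^ 3 := by
  classical
  have h1 := hφ.sum_potential (n + 2)
  rw [_root_.sum_potential] at h1
  have hsub : occupied φ n ⊆ occupied φ (n + 2 + 2) := by
    intro y hy
    obtain ⟨hy, hyφ⟩ := Finset.mem_filter.1 hy
    have h0 : sqDist y y < 6 := by simp [sqDist]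
    exact Finset.mem_filter.2 ⟨mem_cube_of_mem_ball (mem_cube_of_mem_ball hy h0) h0, hyφ⟩
  have h2 : ∑ y ∈ occupied φ n, (12 : ℚ) ≤ ∑ y ∈ occupied φ (n + 2 + 2),
      ∑ x ∈ cube (n + 2) with x ∈ ball y, force (sqDist x y) := by
    refine le_trans (Finset.sum_le_sum fun y hy => ?_) (Finset.sum_le_sum_of_subset_of_nonneg hsub
      fun _ _ _ => Finset.sum_nonneg fun _ _ => force_nonneg _)
    rw [← sum_force_ball y]
    refine Finset.sum_le_sum_of_subset_of_nonneg (fun x hx => ?_) fun _ _ _ => force_nonneg _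
    refine Finset.mem_filter.2 ⟨mem_cube_of_mem_ball (Finset.mem_filter.1 hy).1 ?_, hx⟩
    exact (mem_ball _ _).1 hx
  rw [Finset.sum_const, nsmul_eq_mul] at h2
  have : 12 * ((occupied φ n).card : ℚ) ≤ ((2 * (n + 2) + 1 : ℕ) : ℚ) ^ 3 := by
    push_cast at h1 ⊢
    linarith
  exact_mod_cast this

theorem tendsto_ratio (c : ℝ) :
    Filter.Tendsto (fun n : ℕ => 1 / 12 * ((2 * (n : ℝ) + c) / (2 * (n : ℝ) + 1)) ^ 3)
      Filter.atTop (nhds (1 / 12)) := by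
  have h : Filter.Tendsto (fun n : ℕ => 1 + (c - 1) / (2 * (n : ℝ) + 1)) Filter.atTop
      (nhds (1 + 0)) := by
    refine tendsto_const_nhds.add (Filter.Tendsto.div_atTop tendsto_const_nhds ?_)
    exact Filter.tendsto_atTop_add_const_right _ _
      (tendsto_natCast_atTop_atTop.const_mul_atTop (by norm_num))
  have h2 := ((h.pow 3).const_mul (1 / 12 : ℝ))
  norm_num at h2
  refine (h2.congr fun n => ?_)
  have : (2 * (n : ℝ) + 1) ≠ 0 := by positivity
  field_simp
  ring

theorem IsPerfect.hasDensity {φ : Set Site} (hφ : IsPerfect φ) : HasDensity φ (1 / 12) := by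
  have hcard : ∀ n : ℕ, (φ ∩ Set.Icc (fun _ => -(n : ℤ)) (fun _ => (n : ℤ))).ncard =
      (occupied φ n).card := by
    intro n
    rw [← Set.ncard_coe_finset]
    congr 1
    ext x
    simp [occupied, cube, and_comm]
  unfold HasDensity
  simp only [hcard]
  -- The constants are the side lengths 2(n - 2) + 1 = 2n - 3 and 2(n + 2) + 1 = 2n + 5 of the cubes
  -- in the two bounds.
  refine tendsto_of_tendsto_of_tendsto_of_le_of_le' (tendsto_ratio (-3)) (tendsto_ratio 5) ?_ ?_
  · filter_upwards [Filter.eventually_ge_atTop 2] with n hn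
    obtain ⟨m, rfl⟩ := Nat.exists_eq_add_of_le' hn
    have h : ((2 * m + 1 : ℕ) : ℝ) ^ 3 ≤ 12 * ((occupied φ (m + 2)).card : ℝ) := by
      exact_mod_cast hφ.le_occupied m
    rw [div_pow, ← mul_div_assoc]
    gcongr
    push_cast at h ⊢
    rw [show 2 * ((m : ℝ) + 2) + -3 = 2 * m + 1 by ring]
    linarith
  · filter_upwards with n
    have h : 12 * ((occupied φ n).card : ℝ) ≤ ((2 * (n + 2) + 1 : ℕ) : ℝ) ^ 3 := by
      exact_mod_cast hφ.occupied_le n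
    rw [div_pow, ← mul_div_assoc]
    gcongr
    push_cast at h
    rw [show 2 * (n : ℝ) + 5 = 2 * (n + 2) + 1 by ring]
    linarith

theorem mainTheorem9 :
    {φ : Set Site | IsPerfect φ} = layeredSet ∧
    Cardinal.mk layeredSet = Cardinal.continuum ∧
    {φ : Set Site | IsPerfect φ ∧ IsPeriodic φ} = periodicLayeredSet ∧
    Cardinal.mk periodicLayeredSet = Cardinal.aleph0 ∧
    ∀ φ ∈ layeredSet, HasDensity φ (1 / 12) := by
  have h : ∀ φ, IsPerfect φ ↔ φ ∈ layeredSet := fun φ =>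
    (isPerfect_iff_layers φ).trans (mem_layeredSet φ).symm
  exact ⟨Set.ext h, mk_layeredSet, Set.ext isPerfect_and_isPeriodic_iff, mk_periodicLayeredSet,
    fun φ hφ => ((h φ).2 hφ).hasDensity⟩
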